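/- Let $2<r<\infty$. Let $(\xi(i))_{i\ge 1}$ be real martingale differences on a probability space $(\Omega,\mathcal A,\mathbf P)$ relative to a filtration $F(0)\subset F(1)\subset\dots\subset\mathcal A$ with $F(0)=\{\emptyset,\Omega\}$: each $\xi(k)$ is integrable and $F(k)$-measurable and $\mathbf E(\xi(k)\mid F(k-1))=0$ a.s. for $k\ge1$ (so $\mathbf E\xi(k)=0$). For a random variable $\eta$ put $|\eta|_p=(\mathbf E|\eta|^p)^{1/p}$ and $T_\eta(x)=\mathbf P(|\eta|\ge x)$, and let $$S(n)=n^{-1/2}\sum_{k=1}^n\xi(k),\qquad U(x)=\sup_{n\ge1}T_{S(n)}(x).$$ For $\nu:[1,r)\to[0,\infty)$ put $$\|\eta\|_{G(\nu;r)}=\sup_{2<p<r}\frac{|\eta|_p}{\nu(p)}\ \ (\text{for }\nu>0),\qquad T^{(\nu)}(x)=\inf_{1<p<r}\frac{\nu(p)^p}{x^p},\quad x>0.$$ **(a)** Let $\nu:[1,r)\to(0,\infty)$ be continuous with $\inf_{2<p<r}\nu(p)>0$, and let $K\in[0,\infty)$. There is a constant $C\in(0,\infty)$ depending only on $r,\nu,K$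 such that, for every sequence as above with $\sup_i\|\xi(i)\|_{G(\nu;r)}\le K$, $$U(x)\le C\,T^{(\nu)}(x),\qquad x>0.$$ **(b)** The same inequality holds for the natural function $\nu(p)=\nu_{\{\xi\}}(p)=\sup_{i\ge1}|\xi(i)|_p$, provided that it is finite for all $p\in[1,r)$, with a constant $C\in(0,\infty)$ depending only on $r$ and on the joint law of the sequence $(\xi(i))_{i\ge1}$. **(c)** Let $\gamma\in\mathbb R$ and let $L:[1,\infty)\to(0,\infty)$ be continuous and slowly varying at infinity. There is a constant $C\in(0,\infty)$ depending only on $r,\gamma,L$ such that, for every sequence as above with $$T_{\xi(i)}(x)\le x^{-r}\log^{\gamma}(x)\,L(\log x)\qquad\text{for all }i\ge1,\ x>e,$$ one has $$U(x)\le C\,x^{-r}\log^{\gamma+1}(x)\,L(\log x),\qquad x>e.$$ If the tail condition holds with equality for all $i\ge1$ and $x>e$, then also $x^{-r}\log^{\gamma}(x)\,L(\log x)\le U(x)$ for $x>e$. -/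

import Mathlib

open MeasureTheory ProbabilityTheory Filter Topology Set
open scoped ENNReal NNReal

universe u

noncomputable section

/-- `ξ 1, ξ 2, …` are martingale differences with respect to the filtration `ℱ 0 ⊆ ℱ 1 ⊆ …`, whose
initial term is trivial. The value `ξ 0` plays no role. Since `ℱ 0` is trivial, or by the tower
property, each `ξ (k + 1)` is centered. -/
structure IsMartingaleDifferenceSeq {Ω : Type*} {mΩ : MeasurableSpace Ω} (P : Measure Ω)
    (ℱ : Filtration ℕ mΩ) (ξ : ℕ → Ω → ℝ) : Prop where
  initial : ℱ 0 = ⊥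
  adapted : ∀ k, StronglyMeasurable[ℱ (k + 1)] (ξ (k + 1))
  integrable : ∀ k, Integrable (ξ (k + 1)) P
  condExp_eq_zero : ∀ k, P[ξ (k + 1) | ℱ k] =ᵐ[P] 0

/-- The tail function `T_η(x) = P(|η| ≥ x)`. -/
def tailFun {Ω : Type*} {mΩ : MeasurableSpace Ω} (P : Measure Ω) (η : Ω → ℝ) (x : ℝ) : ℝ≥0∞ :=
  P {ω | x ≤ |η ω|}

/-- The classically normed sum `S(n) = n^{-1/2} (ξ 1 + … + ξ n)`. -/
def normedSum {Ω : Type*} (ξ : ℕ → Ω → ℝ) (n : ℕ) (ω : Ω) : ℝ :=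
  (√(n : ℝ))⁻¹ * ∑ k ∈ Finset.Icc 1 n, ξ k ω

/-- The uniform tail function `U(x) = sup_{n ≥ 1} T_{S(n)}(x)`. -/
def uniformTail {Ω : Type*} {mΩ : MeasurableSpace Ω} (P : Measure Ω) (ξ : ℕ → Ω → ℝ)
    (x : ℝ) : ℝ≥0∞ :=
  ⨆ n : ℕ, ⨆ _ : 1 ≤ n, tailFun P (normedSum ξ n) x

/-- The weights `ν` used to define the moment norm: positive, finite and continuous on `[1, r)` and
bounded away from zero on `(2, r)`. Values of `ν` outside `[1, r)` are never used (by convention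
they are infinite). -/
structure IsMomentWeight (r : ℝ) (ν : ℝ → ℝ≥0∞) : Prop where
  continuousOn : ContinuousOn ν (Ico 1 r)
  pos : ∀ p ∈ Ico 1 r, 0 < ν p
  lt_top : ∀ p ∈ Ico 1 r, ν p < ∞
  iInf_pos : 0 < ⨅ p ∈ Ioo 2 r, ν p

/-- The norm of the Grand Lebesgue ("moment") space `G(ν; r)`:
`sup_{2 < p < r} (E|η|^p)^{1/p} / ν(p)`. -/
def momentNorm {Ω : Type*} {mΩ : MeasurableSpace Ω} (P : Measure Ω) (r : ℝ) (ν : ℝ → ℝ≥0∞)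
    (η : Ω → ℝ) : ℝ≥0∞ :=
  ⨆ p ∈ Ioo 2 r, eLpNorm η (ENNReal.ofReal p) P / ν p

/-- The natural function of the family `ξ 1, ξ 2, …`: `p ↦ sup_{k ≥ 1} (E|ξ k|^p)^{1/p}`. -/
def naturalFun {Ω : Type*} {mΩ : MeasurableSpace Ω} (P : Measure Ω) (ξ : ℕ → Ω → ℝ)
    (p : ℝ) : ℝ≥0∞ :=
  ⨆ k : ℕ, ⨆ _ : 1 ≤ k, eLpNorm (ξ k) (ENNReal.ofReal p) P

/-- The transform `T^{(ν)}(x) = inf_{1 < p < r} ν(p)^p / x^p`, for `x > 0`. -/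
def tailTransform (r : ℝ) (ν : ℝ → ℝ≥0∞) (x : ℝ) : ℝ≥0∞ :=
  ⨅ p ∈ Ioo 1 r, ν p ^ p / ENNReal.ofReal x ^ p

/-- `L : [1, ∞) → (0, ∞)` is positive, continuous, and slowly varying at infinity. -/
structure IsSlowlyVarying (L : ℝ → ℝ) : Prop where
  continuousOn : ContinuousOn L (Ici 1)
  pos : ∀ x, 1 ≤ x → 0 < L x
  tendsto_ratio : ∀ c : ℝ, 0 < c → Tendsto (fun x => L (c * x) / L x) atTop (𝓝 1)

/-- The regularly varying function `x^{-r} (log x)^γ L(log x)`, for `x > e`. -/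
def regTail (r γ : ℝ) (L : ℝ → ℝ) (x : ℝ) : ℝ :=
  x ^ (-r) * Real.log x ^ γ * L (Real.log x)

end

/-! Everything rests on one moment inequality, with a constant uniform in the exponent: if `|ξ(k)|_p
≤ s` for all `k`, then `|S(n)|_p ≤ A s` for all `n` and all `2 ≤ p ≤ R`, where `A = momentConst R`.
It is proved by induction on `n`. In the second order expansion of `|M + ξ|^p` the linear term has
zero expectation, and the remainder is absorbed by the growth of `n^{p/2}`
(`moment_induction_step`). Chebyshev's inequality turns this into `U(x) ≤ (A s / x)^p`
(`uniformTail_le_rpow`).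

For (a) and (b) this is the required bound at each `p` in `(2, r)`, because `A^p ≤ A^r`. The
transform also ranges over `1 < p ≤ 2`; there it suffices to use one fixed exponent above 2, the
trivial bound `U ≤ 1`, and a positive lower bound for the weight.

For (c) the differences are truncated at the level `x` itself and recentred by conditional
expectations. The truncated part is estimated with an exponent `q > r`, the remainder with exponent
2. By Potter-type bounds for the slowly varying factor, both contributions have the order of the
individual tail at `x`. No logarithm is lost, so the result is stronger than the stated one; the
extra factor `log x` exceeds 1 and is inserted only at the end. -/

/-! ### Moment inequality for martingales -/

/-- Second order expansion of `|a + b| ^ p`, with a constant uniform over `2 ≤ p ≤ R`. -/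
theorem abs_add_rpow_le {p R : ℝ} (hp : 2 ≤ p) (hpR : p ≤ R) (a b : ℝ) :
    |a + b| ^ p ≤ |a| ^ p + p * (|a| ^ (p - 2) * a) * b +
      2 * (R + 1) ^ R * (|a| ^ (p - 2) * b ^ 2 + |b| ^ p) := by
  have hp0 : 0 < p := by linarith
  have hcp : ∀ q, 0 ≤ q → q ≤ R → p ^ q ≤ (R + 1) ^ R := fun q hq hqR =>
    (Real.rpow_le_rpow hp0.le (by linarith) hq).trans
      (Real.rpow_le_rpow_of_exponent_le (by linarith) hqR)
  have hcp' : (p + 1) ^ p ≤ (R + 1) ^ R :=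
    (Real.rpow_le_rpow (by linarith) (by linarith) hp0.le).trans
      (Real.rpow_le_rpow_of_exponent_le (by linarith) hpR)
  have hc0 : 0 ≤ (R + 1) ^ R := Real.rpow_nonneg (by linarith) _
  have hA : 0 ≤ |a| ^ (p - 2) := by positivity
  have hB : 0 ≤ |b| ^ p := by positivity
  -- If `|a| < p|b|`, every term is at most a constant times `|b|^p`. Otherwise `t = b/a` satisfies
  -- `|pt| ≤ 1` and a Taylor estimate applies.
  rcases lt_or_ge |a| (p * |b|) with hab | hab
  · have h1 : |a + b| ^ p ≤ (p + 1) ^ p * |b| ^ p := by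
      rw [← Real.mul_rpow (by linarith) (abs_nonneg b)]
      refine Real.rpow_le_rpow (abs_nonneg _) ?_ hp0.le
      have := abs_add_le a b
      nlinarith
    have h2 : -(p * (|a| ^ (p - 2) * a) * b) ≤ p ^ p * |b| ^ p := by
      have hb : 0 < |b| := by
        by_contra! h
        have : |b| = 0 := le_antisymm h (abs_nonneg b)
        rw [this] at hab
        have := abs_nonneg a
        linarith
      have e1 : |a| ^ (p - 2) * |a| = |a| ^ (p - 1) := by
        rw [← Real.rpow_add_one' (abs_nonneg a) (by linarith)]
        congr 1
        ring
      calc -(p * (|a| ^ (p - 2) * a) * b) ≤ |p * (|a| ^ (p - 2) * a) * b| := neg_le_abs _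
        _ = p * |a| ^ (p - 1) * |b| := by
            rw [abs_mul, abs_mul, abs_mul, abs_of_pos hp0, abs_of_nonneg hA, e1]
        _ ≤ p * (p * |b|) ^ (p - 1) * |b| := by
            gcongr
            linarith
        _ = p ^ p * |b| ^ p := by
            rw [Real.mul_rpow hp0.le hb.le, Real.rpow_sub_one hp0.ne', Real.rpow_sub_one hb.ne']
            field_simp
    have h3 := hcp p hp0.le hpR
    have h4 : 0 ≤ |a| ^ p := by positivity
    have h5 : 0 ≤ 2 * (R + 1) ^ R * (|a| ^ (p - 2) * b ^ 2) := by positivity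
    nlinarith [mul_le_mul_of_nonneg_right h3 hB, mul_le_mul_of_nonneg_right hcp' hB]
  · rcases eq_or_ne a 0 with rfl | ha
    · have hb : b = 0 := by
        rw [abs_zero] at hab
        have := abs_nonneg b
        exact abs_eq_zero.1 (by nlinarith)
      subst hb
      simp [Real.zero_rpow hp0.ne']
    have ha' : 0 < |a| := abs_pos.2 ha
    set t := b / a with ht
    have hbt : b = a * t := by rw [ht]; field_simp
    have hpt : |p * t| ≤ 1 := by
      rw [ht, abs_mul, abs_div, abs_of_pos hp0, ← mul_div_assoc]
      exact (div_le_one ha').2 hab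
    have ht1 : |t| ≤ 1 := by
      rw [abs_mul, abs_of_pos hp0] at hpt
      nlinarith [abs_nonneg t]
    -- Passing through `exp (p t)` avoids differentiating the power and keeps the constant explicit
    -- in `p`.
    have hexp : (1 + t) ^ p ≤ 1 + p * t + p ^ 2 * t ^ 2 := by
      calc (1 + t) ^ p ≤ Real.exp t ^ p := by
            refine Real.rpow_le_rpow (by linarith [(abs_le.1 ht1).1]) ?_ hp0.le
            linarith [Real.add_one_le_exp t]
        _ = Real.exp (p * t) := by rw [← Real.exp_mul, mul_comm]
        _ ≤ _ := by
            have := (abs_le.1 (Real.abs_exp_sub_one_sub_id_le hpt)).2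
            nlinarith
    have hap : |a| ^ p = |a| ^ (p - 2) * a ^ 2 := by
      rw [← sq_abs a, ← Real.rpow_natCast, ← Real.rpow_add ha']
      congr 1
      push_cast
      ring
    have h1 : |a + b| ^ p = |a| ^ p * (1 + t) ^ p := by
      have h0 : 0 ≤ 1 + t := by linarith [(abs_le.1 ht1).1]
      have h3 : a + b = a * (1 + t) := by rw [hbt]; ring
      rw [h3, abs_mul, abs_of_nonneg h0, Real.mul_rpow ha'.le h0]
    have h2 : p ^ 2 ≤ (R + 1) ^ R := by
      have := hcp 2 (by norm_num) (by linarith)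
      exact_mod_cast this
    calc |a + b| ^ p ≤ |a| ^ p * (1 + p * t + p ^ 2 * t ^ 2) := by
          rw [h1]; gcongr
      _ = |a| ^ p + p * (|a| ^ (p - 2) * a) * b + p ^ 2 * (|a| ^ (p - 2) * b ^ 2) := by
          rw [mul_add, mul_add, mul_one, hbt, hap]; ring
      _ ≤ _ := by
          have h6 : 0 ≤ |a| ^ (p - 2) * b ^ 2 := by positivity
          nlinarith [mul_le_mul_of_nonneg_right h2 h6, mul_nonneg hc0 h6, mul_nonneg hc0 hB]

/-- A crude form of Young's inequality: replace both bases by the larger one. -/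
theorem rpow_mul_rpow_le_add {x y p q : ℝ} (hx : 0 ≤ x) (hy : 0 ≤ y) (hq : 0 ≤ q) (hqp : q ≤ p) :
    x ^ (p - q) * y ^ q ≤ x ^ p + y ^ p := by
  have key : ∀ z : ℝ, 0 ≤ z → x ≤ z → y ≤ z → x ^ (p - q) * y ^ q ≤ z ^ p := by
    intro z hz hxz hyz
    calc x ^ (p - q) * y ^ q ≤ z ^ (p - q) * z ^ q := by gcongr
      _ ≤ z ^ p := by
        have := Real.rpow_add_of_nonneg hz (sub_nonneg.2 hqp) hq
        rw [sub_add_cancel] at this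
        exact this.ge
  have h1 : 0 ≤ x ^ p := by positivity
  have h2 : 0 ≤ y ^ p := by positivity
  rcases le_total x y with h | h
  · linarith [key y hy h le_rfl]
  · linarith [key x hx le_rfl h]

/-- Plays the role of Hölder's inequality. With `m` and `s` bounds for the `L^p` norms of `a` and
`b`, the last bracket integrates to at most 2. -/
theorem abs_rpow_mul_sq_le {a b m s p : ℝ} (hm : 0 < m) (hs : 0 < s) (hp : 2 ≤ p) :
    |a| ^ (p - 2) * b ^ 2 ≤
      m ^ (p - 2) * s ^ 2 * (|a| ^ p / m ^ p + |b| ^ p / s ^ p) := by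
  have h := rpow_mul_rpow_le_add (x := |a| / m) (y := |b| / s) (p := p) (q := 2)
    (by positivity) (by positivity) (by norm_num) hp
  rw [Real.div_rpow (abs_nonneg a) hm.le, Real.div_rpow (abs_nonneg a) hm.le,
    Real.div_rpow (abs_nonneg b) hs.le p, Real.rpow_two, div_pow, sq_abs] at h
  have h0 : 0 < m ^ (p - 2) := by positivity
  calc |a| ^ (p - 2) * b ^ 2
      = m ^ (p - 2) * s ^ 2 * (|a| ^ (p - 2) / m ^ (p - 2) * (b ^ 2 / s ^ 2)) := by field_simp
    _ ≤ _ := by gcongr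

theorem MeasureTheory.MemLp.integrable_abs_rpow {Ω : Type*} {mΩ : MeasurableSpace Ω}
    {P : Measure Ω} {f : Ω → ℝ} {p : ℝ} (hp : 0 < p) (hf : MemLp f (ENNReal.ofReal p) P) :
    Integrable (fun ω => |f ω| ^ p) P := by
  have := hf.integrable_norm_rpow (by simpa using hp) ENNReal.ofReal_ne_top
  simpa [ENNReal.toReal_ofReal hp.le] using this

/-- The `p`-th moment of a martingale after one more step. -/
theorem integral_abs_add_rpow_le {Ω : Type*} {m mΩ : MeasurableSpace Ω} {P : Measure Ω}
    [IsProbabilityMeasure P] (hmΩ : m ≤ mΩ) {M ξ : Ω → ℝ} {p R c s : ℝ} (hp : 2 ≤ p) (hpR : p ≤ R)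
    (hM : StronglyMeasurable[m] M) (hMp : MemLp M (ENNReal.ofReal p) P)
    (hξp : MemLp ξ (ENNReal.ofReal p) P) (hξ : P[ξ | m] =ᵐ[P] 0) (hc : 0 < c) (hs : 0 < s)
    (hMc : ∫ ω, |M ω| ^ p ∂P ≤ c ^ p) (hξs : ∫ ω, |ξ ω| ^ p ∂P ≤ s ^ p) :
    ∫ ω, |M ω + ξ ω| ^ p ∂P ≤
      c ^ p + 2 * (R + 1) ^ R * (2 * (c ^ (p - 2) * s ^ 2) + s ^ p) := by
  have hp0 : 0 < p := by linarith
  have hR0 : 0 ≤ (R + 1) ^ R := by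
    have : 0 ≤ R + 1 := by linarith
    positivity
  have iM := hMp.integrable_abs_rpow hp0
  have iξ := hξp.integrable_abs_rpow hp0
  have hg : StronglyMeasurable[m] (fun ω => |M ω| ^ (p - 2) * M ω) := by
    have hcont : Continuous fun t : ℝ => |t| ^ (p - 2) * t :=
      (continuous_abs.rpow_const fun _ => Or.inr (by linarith)).mul continuous_id
    exact hcont.comp_stronglyMeasurable hM
  have hgξ : Integrable ((fun ω => |M ω| ^ (p - 2) * M ω) * ξ) P := by
    refine (iM.add iξ).mono' ((hg.mono hmΩ).aestronglyMeasurable.mul hξp.1) (ae_of_all _ fun ω => ?_)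
    have e1 : |M ω| ^ (p - 2) * |M ω| = |M ω| ^ (p - 1) := by
      rw [← Real.rpow_add_one' (abs_nonneg _) (by linarith)]
      congr 1
      ring
    simp only [Pi.mul_apply, Pi.add_apply, Real.norm_eq_abs, abs_mul]
    rw [abs_of_nonneg (by positivity : 0 ≤ |M ω| ^ (p - 2)), e1]
    have := rpow_mul_rpow_le_add (p := p) (q := 1) (abs_nonneg (M ω)) (abs_nonneg (ξ ω))
      zero_le_one (by linarith)
    rwa [Real.rpow_one] at this
  -- The factor `|M|^{p-2} M` is `m`-measurable, so it comes out of the conditional expectation of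
  -- the product, which then vanishes.
  have hzero : ∫ ω, ((fun ω => |M ω| ^ (p - 2) * M ω) * ξ) ω ∂P = 0 := by
    rw [← integral_condExp hmΩ]
    have h1 := condExp_mul_of_stronglyMeasurable_left hg hgξ
      (hξp.integrable (by simpa using (by linarith : (1 : ℝ) ≤ p)))
    have h2 : P[(fun ω => |M ω| ^ (p - 2) * M ω) * ξ | m] =ᵐ[P] 0 := by
      filter_upwards [h1, hξ] with ω h1 h2
      rw [h1, Pi.mul_apply, h2]
      simp
    rw [integral_congr_ae h2]
    simp
  have hbound : ∀ ω, |M ω + ξ ω| ^ p ≤ |M ω| ^ p +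
      p * ((fun ω => |M ω| ^ (p - 2) * M ω) * ξ) ω + 2 * (R + 1) ^ R *
        (c ^ (p - 2) * s ^ 2 * (|M ω| ^ p / c ^ p + |ξ ω| ^ p / s ^ p) + |ξ ω| ^ p) := by
    intro ω
    have h1 := abs_add_rpow_le hp hpR (M ω) (ξ ω)
    have h2 := abs_rpow_mul_sq_le (a := M ω) (b := ξ ω) hc hs hp
    simp only [Pi.mul_apply]
    calc _ ≤ _ := h1
      _ ≤ _ := by
        rw [mul_assoc p]
        gcongr
  have i3 : Integrable (fun ω => 2 * (R + 1) ^ R *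
        (c ^ (p - 2) * s ^ 2 * (|M ω| ^ p / c ^ p + |ξ ω| ^ p / s ^ p) + |ξ ω| ^ p)) P :=
    ((((iM.div_const _).add (iξ.div_const _)).const_mul _).add iξ).const_mul _
  have i4 : Integrable (fun ω => |M ω| ^ p +
      p * ((fun ω => |M ω| ^ (p - 2) * M ω) * ξ) ω) P := iM.add (hgξ.const_mul p)
  calc ∫ ω, |M ω + ξ ω| ^ p ∂P ≤ _ :=
        integral_mono ((hMp.add hξp).integrable_abs_rpow hp0) (i4.add i3) hbound
    _ = ∫ ω, |M ω| ^ p ∂P + 2 * (R + 1) ^ R * (c ^ (p - 2) * s ^ 2 *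
        ((∫ ω, |M ω| ^ p ∂P) / c ^ p + (∫ ω, |ξ ω| ^ p ∂P) / s ^ p) + ∫ ω, |ξ ω| ^ p ∂P) := by
        simp only [Pi.add_apply]
        have i5 : Integrable (fun ω => c ^ (p - 2) * s ^ 2 *
            (|M ω| ^ p / c ^ p + |ξ ω| ^ p / s ^ p)) P :=
          ((iM.div_const _).add (iξ.div_const _)).const_mul _
        rw [integral_add i4 i3, integral_add iM (hgξ.const_mul p), integral_const_mul, hzero,
          integral_const_mul, integral_add i5 iξ, integral_const_mul,
          integral_add (iM.div_const _) (iξ.div_const _), integral_div, integral_div]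
        ring
    _ ≤ c ^ p + 2 * (R + 1) ^ R * (c ^ (p - 2) * s ^ 2 * (c ^ p / c ^ p + s ^ p / s ^ p) + s ^ p) := by
        gcongr
    _ = _ := by
        rw [div_self (by positivity), div_self (by positivity)]
        ring

/-- The constant in the moment inequality for martingales, uniform over exponents in `[2, R]`. -/
noncomputable def momentConst (R : ℝ) : ℝ := √(6 * (R + 1) ^ R)

theorem one_le_momentConst {R : ℝ} (hR : 0 ≤ R) : 1 ≤ momentConst R := by
  have : 1 ≤ (R + 1) ^ R := Real.one_le_rpow (by linarith) hR
  rw [momentConst, Real.one_le_sqrt]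
  linarith

/-- Bernoulli's inequality with exponent `p/2 ≥ 1` gives `√(x+1)^p ≥ √x^p + √x^{p-2}`. Multiplied by
`A^p`, where `A^2 = 6D` and `D = (R+1)^R`, the gain is `6D (A√x)^{p-2}`. This covers the `4D` and
`2D` terms because `A√x ≥ 1`. -/
theorem moment_induction_step {p R s x : ℝ} (hp : 2 ≤ p) (hpR : p ≤ R) (hs : 0 < s) (hx : 1 ≤ x) :
    (momentConst R * √x * s) ^ p + 2 * (R + 1) ^ R *
      (2 * ((momentConst R * √x * s) ^ (p - 2) * s ^ 2) + s ^ p) ≤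
    (momentConst R * √(x + 1) * s) ^ p := by
  set A := momentConst R with hA
  have hA1 : 1 ≤ A := one_le_momentConst (by linarith)
  have hA0 : 0 < A := by linarith
  have hx0 : 0 < x := by linarith
  set D := (R + 1) ^ R with hD
  have hA2 : A ^ 2 = 6 * D := by
    rw [hA, momentConst, Real.sq_sqrt]
    have : 0 ≤ R + 1 := by linarith
    positivity
  have hpow : ∀ y : ℝ, 0 < y → y ^ p = y ^ (p - 2) * y ^ 2 := by
    intro y hy
    rw [← Real.rpow_natCast, ← Real.rpow_add hy]
    congr 1
    push_cast
    ring
  have hsq : ∀ y : ℝ, 0 ≤ y → √y ^ p = y ^ (p / 2) := by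
    intro y hy
    rw [Real.sqrt_eq_rpow, ← Real.rpow_mul hy]
    congr 1
    ring
  have hgrow : √x ^ p + √x ^ (p - 2) ≤ √(x + 1) ^ p := by
    have h1 := one_add_mul_self_le_rpow_one_add (s := 1 / x) (p := p / 2)
      (by have : 0 < 1 / x := by positivity
          linarith) (by linarith)
    have h2 : √(x + 1) ^ p = √x ^ p * (1 + 1 / x) ^ (p / 2) := by
      rw [hsq _ (by linarith), hsq _ hx0.le, ← Real.mul_rpow hx0.le (by positivity)]
      congr 1
      field_simp
    have h3 : √x ^ p = √x ^ (p - 2) * x := by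
      rw [hpow _ (by positivity), Real.sq_sqrt hx0.le]
    have h4 : 1 + 1 / x ≤ 1 + p / 2 * (1 / x) := by
      have : 0 < 1 / x := by positivity
      nlinarith
    calc √x ^ p + √x ^ (p - 2) = √x ^ p * (1 + 1 / x) := by
          rw [h3]; field_simp
      _ ≤ √x ^ p * (1 + 1 / x) ^ (p / 2) := by
          gcongr
          exact h4.trans h1
      _ = _ := h2.symm
  have hU : 1 ≤ (A * √x) ^ (p - 2) := by
    refine Real.one_le_rpow ?_ (by linarith)
    have : 1 ≤ √x := Real.one_le_sqrt.2 hx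
    nlinarith
  have hD0 : 0 < D := by nlinarith
  have hsp : 0 < s ^ p := by positivity
  have e0 : (A * √x * s) ^ (p - 2) * s ^ 2 = (A * √x) ^ (p - 2) * s ^ p := by
    rw [Real.mul_rpow (by positivity) hs.le, hpow s hs]
    ring
  have e2 : ∀ y : ℝ, (A * √y * s) ^ p = A ^ p * √y ^ p * s ^ p := fun y => by
    rw [Real.mul_rpow (by positivity) hs.le, Real.mul_rpow hA0.le (by positivity)]
  rw [e0, e2, e2]
  have e1 : A ^ p * √x ^ (p - 2) = 6 * D * (A * √x) ^ (p - 2) := by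
    rw [hpow A hA0, Real.mul_rpow hA0.le (by positivity), hA2]
    ring
  have hfin : A ^ p * √x ^ p + 2 * D * (2 * (A * √x) ^ (p - 2) + 1) ≤ A ^ p * √(x + 1) ^ p := by
    have : A ^ p * (√x ^ p + √x ^ (p - 2)) ≤ A ^ p * √(x + 1) ^ p := by gcongr
    nlinarith [mul_le_mul_of_nonneg_left hU hD0.le]
  calc _ = (A ^ p * √x ^ p + 2 * D * (2 * (A * √x) ^ (p - 2) + 1)) * s ^ p := by ring
    _ ≤ _ := by gcongr

/-- The moment inequality for sums of martingale differences with bounded `p`-th moments. -/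
theorem integral_abs_sum_rpow_le {Ω : Type*} {mΩ : MeasurableSpace Ω} {P : Measure Ω}
    [IsProbabilityMeasure P] {ℱ : Filtration ℕ mΩ} {d : ℕ → Ω → ℝ} {p R s : ℝ}
    (hp : 2 ≤ p) (hpR : p ≤ R) (hs : 0 < s) (hd : ∀ k, StronglyMeasurable[ℱ (k + 1)] (d k))
    (hmem : ∀ k, MemLp (d k) (ENNReal.ofReal p) P) (hc : ∀ k, P[d k | ℱ k] =ᵐ[P] 0)
    (hds : ∀ k, ∫ ω, |d k ω| ^ p ∂P ≤ s ^ p) (n : ℕ) :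
    ∫ ω, |∑ k ∈ Finset.range (n + 1), d k ω| ^ p ∂P ≤
      (momentConst R * √((n : ℝ) + 1) * s) ^ p := by
  have hA : 1 ≤ momentConst R := one_le_momentConst (by linarith)
  induction n with
  | zero =>
    simp only [zero_add, Finset.range_one, Finset.sum_singleton, Nat.cast_zero, Real.sqrt_one,
      mul_one]
    refine (hds 0).trans (Real.rpow_le_rpow hs.le ?_ (by linarith))
    nlinarith
  | succ n ih =>
    have hS : StronglyMeasurable[ℱ (n + 1)] (fun ω => ∑ k ∈ Finset.range (n + 1), d k ω) := by
      refine Finset.stronglyMeasurable_fun_sum _ fun k hk => (hd k).mono (ℱ.mono ?_)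
      have := Finset.mem_range.1 hk
      omega
    have hSp : MemLp (fun ω => ∑ k ∈ Finset.range (n + 1), d k ω) (ENNReal.ofReal p) P :=
      memLp_finsetSum _ fun k _ => hmem k
    have h := integral_abs_add_rpow_le (ℱ.le (n + 1)) hp hpR hS hSp (hmem (n + 1)) (hc (n + 1))
      (by positivity) hs ih (hds (n + 1))
    simp only [Finset.sum_range_succ _ (n + 1)]
    push_cast
    exact h.trans (moment_induction_step hp hpR hs (by
      have : (0 : ℝ) ≤ n := n.cast_nonneg
      linarith))

/-! ### From moments to uniform tails -/

/-- The tail of the normed sums of martingale differences with bounded `p`-th moments. -/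
theorem tailFun_normedSum_le {Ω : Type*} {mΩ : MeasurableSpace Ω} {P : Measure Ω}
    [IsProbabilityMeasure P] {ℱ : Filtration ℕ mΩ} {ξ : ℕ → Ω → ℝ} {p R s x : ℝ}
    (hp : 2 ≤ p) (hpR : p ≤ R) (hs : 0 < s)
    (hd : ∀ k, StronglyMeasurable[ℱ (k + 1)] (ξ (k + 1)))
    (hmem : ∀ k, MemLp (ξ (k + 1)) (ENNReal.ofReal p) P) (hc : ∀ k, P[ξ (k + 1) | ℱ k] =ᵐ[P] 0)
    (hds : ∀ k, ∫ ω, |ξ (k + 1) ω| ^ p ∂P ≤ s ^ p) {n : ℕ} (hn : 1 ≤ n) (hx : 0 < x) :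
    tailFun P (normedSum ξ n) x ≤ ENNReal.ofReal ((momentConst R * s / x) ^ p) := by
  obtain ⟨n, rfl⟩ : ∃ m, n = m + 1 := ⟨n - 1, by omega⟩
  have hp0 : 0 < p := by linarith
  have hA : 1 ≤ momentConst R := one_le_momentConst (by linarith)
  have h := integral_abs_sum_rpow_le hp hpR hs hd hmem hc hds n
  have hSp : MemLp (fun ω => ∑ k ∈ Finset.range (n + 1), ξ (k + 1) ω) (ENNReal.ofReal p) P :=
    memLp_finsetSum _ fun k _ => hmem k
  have hn0 : (0 : ℝ) < (n : ℝ) + 1 := by positivity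
  set y := √((n : ℝ) + 1) * x with hy
  have hy0 : 0 < y := by positivity
  have hset : {ω | x ≤ |normedSum ξ (n + 1) ω|} =
      {ω | y ^ p ≤ |∑ k ∈ Finset.range (n + 1), ξ (k + 1) ω| ^ p} := by
    ext ω
    have e : ∑ k ∈ Finset.Icc 1 (n + 1), ξ k ω = ∑ k ∈ Finset.range (n + 1), ξ (k + 1) ω := by
      rw [Finset.range_eq_Ico, Finset.sum_Ico_add' (fun k => ξ k ω) 0 (n + 1) 1]
      rfl
    simp only [mem_ofPred_eq, normedSum, e]
    rw [Real.rpow_le_rpow_iff hy0.le (abs_nonneg _) hp0, abs_mul, abs_inv,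
      abs_of_nonneg (Real.sqrt_nonneg _), hy]
    push_cast
    rw [inv_mul_eq_div, le_div_iff₀ (by positivity), mul_comm]
  have hmk := mul_meas_ge_le_integral_of_nonneg (μ := P)
    (ae_of_all _ fun ω => by positivity) (hSp.integrable_abs_rpow hp0) (y ^ p)
  rw [tailFun, hset, ← ofReal_measureReal]
  refine ENNReal.ofReal_le_ofReal ?_
  have hyp : 0 < y ^ p := by positivity
  have : P.real {ω | y ^ p ≤ |∑ k ∈ Finset.range (n + 1), ξ (k + 1) ω| ^ p} ≤
      (momentConst R * √((n : ℝ) + 1) * s) ^ p / y ^ p := by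
    rw [le_div_iff₀ hyp, mul_comm]
    exact hmk.trans h
  refine this.trans (le_of_eq ?_)
  rw [← Real.div_rpow (by positivity) hy0.le, hy]
  congr 1
  field_simp

theorem MeasureTheory.MemLp.integral_abs_rpow_le {Ω : Type*} {mΩ : MeasurableSpace Ω}
    {P : Measure Ω} {f : Ω → ℝ} {p s : ℝ} (hp : 0 < p) (hs : 0 ≤ s)
    (hf : MemLp f (ENNReal.ofReal p) P) (h : eLpNorm f (ENNReal.ofReal p) P ≤ ENNReal.ofReal s) :
    ∫ ω, |f ω| ^ p ∂P ≤ s ^ p := by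
  have hp' : ENNReal.ofReal p ≠ 0 := by simpa using hp
  rw [hf.eLpNorm_eq_integral_rpow_norm hp' ENNReal.ofReal_ne_top,
    ENNReal.ofReal_le_ofReal_iff hs, ENNReal.toReal_ofReal hp.le] at h
  simp only [Real.norm_eq_abs] at h
  have h0 : 0 ≤ ∫ ω, |f ω| ^ p ∂P := integral_nonneg fun ω => by positivity
  calc ∫ ω, |f ω| ^ p ∂P = ((∫ ω, |f ω| ^ p ∂P) ^ p⁻¹) ^ p := by
        rw [← Real.rpow_mul h0, inv_mul_cancel₀ hp.ne', Real.rpow_one]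
    _ ≤ s ^ p := by gcongr

theorem uniformTail_le_one {Ω : Type*} {mΩ : MeasurableSpace Ω} (P : Measure Ω)
    [IsProbabilityMeasure P] (ξ : ℕ → Ω → ℝ) (x : ℝ) : uniformTail P ξ x ≤ 1 :=
  iSup₂_le fun _ _ => prob_le_one

namespace IsMartingaleDifferenceSeq

variable {Ω : Type*} {mΩ : MeasurableSpace Ω} {P : Measure Ω} {ℱ : Filtration ℕ mΩ}
  {ξ : ℕ → Ω → ℝ}

/-- The constant depends on `R` and not on `p`, which later permits an infimum over `p`. -/
theorem uniformTail_le_rpow [IsProbabilityMeasure P] (h : IsMartingaleDifferenceSeq P ℱ ξ)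
    {p R s x : ℝ} (hp : 2 ≤ p) (hpR : p ≤ R) (hs : 0 < s) (hx : 0 < x)
    (hξ : ∀ k, eLpNorm (ξ (k + 1)) (ENNReal.ofReal p) P ≤ ENNReal.ofReal s) :
    uniformTail P ξ x ≤ ENNReal.ofReal ((momentConst R * s / x) ^ p) := by
  have hm : ∀ k, MemLp (ξ (k + 1)) (ENNReal.ofReal p) P := fun k =>
    ⟨(h.integrable k).1, (hξ k).trans_lt ENNReal.ofReal_lt_top⟩
  exact iSup₂_le fun n hn => tailFun_normedSum_le hp hpR hs h.adapted hm h.condExp_eq_zero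
    (fun k => (hm k).integral_abs_rpow_le (by linarith) hs.le (hξ k)) hn hx

/-- Moment bounds `|ξ k|_p ≤ K w(p)` for `2 < p < r` give a tail bound by the transform of `w`, as
soon as `w` is bounded away from zero on `(1, 2]`. -/
theorem uniformTail_le_tailTransform [IsProbabilityMeasure P]
    (h : IsMartingaleDifferenceSeq P ℱ ξ) {r K c W : ℝ} (hr : 2 < r) (hK : 1 ≤ K) (hc : 0 < c)
    (hc1 : c ≤ 1) (hW : 0 < W) {w : ℝ → ℝ≥0∞} (hw0 : ∀ p ∈ Ioo 2 r, 0 < w p)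
    (hwt : ∀ p ∈ Ioo 2 r, w p < ∞) (hwc : ∀ p ∈ Ioc 1 2, ENNReal.ofReal c ≤ w p)
    (hwW : w ((2 + r) / 2) ≤ ENNReal.ofReal W)
    (hξ : ∀ p ∈ Ioo 2 r, ∀ k, eLpNorm (ξ (k + 1)) (ENNReal.ofReal p) P ≤ ENNReal.ofReal K * w p)
    {x : ℝ} (hx : 0 < x) :
    uniformTail P ξ x ≤ ENNReal.ofReal ((momentConst r * K) ^ r +
      ((momentConst r * (K * W)) ^ ((2 + r) / 2) + 1) / c ^ 2) * tailTransform r w x := by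
  have hA := one_le_momentConst (R := r) (by linarith)
  have hAK : 1 ≤ momentConst r * K := by nlinarith
  set p₀ := (2 + r) / 2 with hp₀
  have hp₀r : p₀ ∈ Ioo 2 r := ⟨by linarith, by linarith⟩
  set C₁ := (momentConst r * K) ^ r with hC₁
  set C₂ := (momentConst r * (K * W)) ^ p₀ with hC₂
  have hC₁0 : 0 ≤ C₁ := by positivity
  have hC₂0 : 0 ≤ C₂ := by positivity
  have hC : 0 < C₁ + (C₂ + 1) / c ^ 2 := by positivity
  have hC' : ENNReal.ofReal (C₁ + (C₂ + 1) / c ^ 2) ≠ 0 := by simpa using hC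
  -- The constant is moved to the left so that the infimum can be tested one exponent at a time.
  rw [mul_comm, ← ENNReal.div_le_iff hC' ENNReal.ofReal_ne_top]
  refine le_iInf₂ fun p hp => ?_
  rw [ENNReal.div_le_iff hC' ENNReal.ofReal_ne_top]
  rcases lt_or_ge 2 p with h2 | h2
  · have hpr : p ∈ Ioo 2 r := ⟨h2, hp.2⟩
    have hwp : ENNReal.ofReal (w p).toReal = w p := ENNReal.ofReal_toReal (hwt p hpr).ne
    have hw : 0 < (w p).toReal := ENNReal.toReal_pos (hw0 p hpr).ne' (hwt p hpr).ne
    have h1 := h.uniformTail_le_rpow h2.le hp.2.le (s := K * (w p).toReal) (by positivity) hx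
      (fun k => by
        rw [ENNReal.ofReal_mul (by linarith), hwp]
        exact hξ p hpr k)
    refine h1.trans ?_
    generalize (w p).toReal = y at hwp hw h1 ⊢
    rw [← hwp, ENNReal.ofReal_rpow_of_pos hw, ENNReal.ofReal_rpow_of_pos hx,
      ← ENNReal.ofReal_div_of_pos (by positivity), ← ENNReal.ofReal_mul (by positivity)]
    refine ENNReal.ofReal_le_ofReal ?_
    have e : (momentConst r * (K * y) / x) ^ p =
        y ^ p / x ^ p * (momentConst r * K) ^ p := by
      rw [← mul_assoc, Real.div_rpow (by positivity) hx.le, Real.mul_rpow (by positivity) hw.le]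
      ring
    rw [e]
    gcongr
    have h3 : (momentConst r * K) ^ p ≤ C₁ := Real.rpow_le_rpow_of_exponent_le hAK hp.2.le
    have : 0 ≤ (C₂ + 1) / c ^ 2 := by positivity
    linarith
  · have hp0 : 0 < p := by linarith [hp.1]
    have hcp : c ^ 2 ≤ c ^ p := by
      rw [← Real.rpow_two]
      exact Real.rpow_le_rpow_of_exponent_ge hc hc1 h2
    -- No moment hypothesis is available at exponents `p ≤ 2`. For `x ≥ 1` the bound at `p₀ > 2`
    -- decays faster than `x^{-p}`; for `x ≤ 1` the right side is at least 1.
    have hU : uniformTail P ξ x ≤ ENNReal.ofReal ((C₂ + 1) / x ^ p) := by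
      rcases le_total 1 x with hx1 | hx1
      · have h1 := h.uniformTail_le_rpow hp₀r.1.le hp₀r.2.le (s := K * W) (by positivity) hx
          (fun k => (hξ p₀ hp₀r k).trans (by
            rw [ENNReal.ofReal_mul (by linarith)]
            gcongr))
        refine h1.trans (ENNReal.ofReal_le_ofReal ?_)
        rw [Real.div_rpow (by positivity) hx.le]
        gcongr
        · linarith
        · linarith [hp₀r.1]
      · refine (uniformTail_le_one P ξ x).trans ?_
        rw [← ENNReal.ofReal_one]
        refine ENNReal.ofReal_le_ofReal ?_
        rw [le_div_iff₀ (by positivity)]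
        have := Real.rpow_le_one hx.le hx1 hp0.le
        linarith
    refine hU.trans ?_
    calc ENNReal.ofReal ((C₂ + 1) / x ^ p)
        ≤ ENNReal.ofReal (c ^ p / x ^ p * (C₁ + (C₂ + 1) / c ^ 2)) := by
          refine ENNReal.ofReal_le_ofReal ?_
          rw [div_mul_eq_mul_div]
          gcongr
          calc C₂ + 1 = c ^ 2 * ((C₂ + 1) / c ^ 2) := by field_simp
            _ ≤ c ^ p * (C₁ + (C₂ + 1) / c ^ 2) := by
              gcongr
              linarith
      _ = ENNReal.ofReal c ^ p / ENNReal.ofReal x ^ p *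
            ENNReal.ofReal (C₁ + (C₂ + 1) / c ^ 2) := by
          rw [ENNReal.ofReal_mul (by positivity), ENNReal.ofReal_div_of_pos (by positivity),
            ENNReal.ofReal_rpow_of_pos hc, ENNReal.ofReal_rpow_of_pos hx]
      _ ≤ _ := by
          gcongr
          exact hwc p ⟨hp.1, h2⟩

end IsMartingaleDifferenceSeq

/-- The lower bound for the weight on `(1, 2]` is its minimum over the compact interval `[1, 2]`,
capped at 1. The norm bound is enlarged to `K + 1` so that powers of it increase with the exponent.
-/
theorem exists_uniformTail_le_of_momentWeight {r : ℝ} (hr : 2 < r) {ν : ℝ → ℝ≥0∞}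
    (hν : IsMomentWeight r ν) (K : ℝ≥0) : ∃ C : ℝ, 0 < C ∧
      ∀ (Ω : Type u) (mΩ : MeasurableSpace Ω) (P : Measure Ω) (_ : IsProbabilityMeasure P)
        (ℱ : Filtration ℕ mΩ) (ξ : ℕ → Ω → ℝ), IsMartingaleDifferenceSeq P ℱ ξ →
        (⨆ i : ℕ, ⨆ _ : 1 ≤ i, momentNorm P r ν (ξ i)) ≤ K →
        ∀ x : ℝ, 0 < x → uniformTail P ξ x ≤ ENNReal.ofReal C * tailTransform r ν x := by
  have hsub : Icc (1 : ℝ) 2 ⊆ Ico 1 r := fun p hp => ⟨hp.1, hp.2.trans_lt hr⟩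
  have hsub' : Ioo 2 r ⊆ Ico 1 r := fun p hp => ⟨by linarith [hp.1], hp.2⟩
  obtain ⟨q, hq, hmin⟩ := isCompact_Icc.exists_isMinOn (nonempty_Icc.2 (by norm_num))
    (hν.continuousOn.mono hsub)
  have hq0 : 0 < (ν q).toReal :=
    ENNReal.toReal_pos (hν.pos q (hsub hq)).ne' (hν.lt_top q (hsub hq)).ne
  have hp₀ : (2 + r) / 2 ∈ Ico 1 r := ⟨by linarith, by linarith⟩
  have hA := one_le_momentConst (R := r) (by linarith)
  have hW : 0 < (ν ((2 + r) / 2)).toReal :=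
    ENNReal.toReal_pos (hν.pos _ hp₀).ne' (hν.lt_top _ hp₀).ne
  have hc : 0 < min 1 (ν q).toReal := lt_min one_pos hq0
  have hK : (1 : ℝ) ≤ K + 1 := by
    have := K.coe_nonneg
    linarith
  refine ⟨_, ?_, fun Ω mΩ P _ ℱ ξ h hξ x hx => h.uniformTail_le_tailTransform hr hK hc
    (min_le_left _ _) hW (fun p hp => hν.pos p (hsub' hp)) (fun p hp => hν.lt_top p (hsub' hp))
    (fun p hp => ?_) (ENNReal.ofReal_toReal (hν.lt_top _ hp₀).ne).ge (fun p hp k => ?_) hx⟩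
  · positivity
  · calc ENNReal.ofReal (min 1 (ν q).toReal) ≤ ENNReal.ofReal (ν q).toReal :=
          ENNReal.ofReal_le_ofReal (min_le_right _ _)
      _ = ν q := ENNReal.ofReal_toReal (hν.lt_top q (hsub hq)).ne
      _ ≤ ν p := hmin ⟨hp.1.le, hp.2⟩
  · have h1 : eLpNorm (ξ (k + 1)) (ENNReal.ofReal p) P / ν p ≤ K :=
      (le_iSup₂ (f := fun p (_ : p ∈ Ioo 2 r) =>
        eLpNorm (ξ (k + 1)) (ENNReal.ofReal p) P / ν p) p hp).trans
        ((le_iSup₂ (f := fun i (_ : 1 ≤ i) => momentNorm P r ν (ξ i)) (k + 1) (by omega)).trans hξ)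
    rw [ENNReal.div_le_iff (hν.pos p (hsub' hp)).ne' (hν.lt_top p (hsub' hp)).ne] at h1
    refine h1.trans ?_
    gcongr
    rw [← ENNReal.ofReal_coe_nnreal]
    exact ENNReal.ofReal_le_ofReal (by linarith)

/-! ### The natural function as weight -/

/-- Shows that the natural function is determined by the joint law, so constants built from it
depend on the law alone. -/
theorem naturalFun_eq_iSup_map {Ω : Type*} {mΩ : MeasurableSpace Ω} {P : Measure Ω}
    {ξ : ℕ → Ω → ℝ} (hξ : ∀ k, AEMeasurable (ξ (k + 1)) P) (p : ℝ) :
    naturalFun P ξ p = ⨆ k : ℕ, eLpNorm (fun f : ℕ → ℝ => f k) (ENNReal.ofReal p)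
      (P.map fun ω k => ξ (k + 1) ω) := by
  have e : ∀ k : ℕ, eLpNorm (fun f : ℕ → ℝ => f k) (ENNReal.ofReal p)
      (P.map fun ω k => ξ (k + 1) ω) = eLpNorm (ξ (k + 1)) (ENNReal.ofReal p) P := fun k =>
    eLpNorm_map_measure (measurable_pi_apply k).aestronglyMeasurable (aemeasurable_pi_lambda _ hξ)
  simp only [e]
  refine le_antisymm (iSup₂_le fun k hk => ?_) (iSup_le fun k => ?_)
  · obtain ⟨m, rfl⟩ : ∃ m, k = m + 1 := ⟨k - 1, by omega⟩
    exact le_iSup (fun k => eLpNorm (ξ (k + 1)) (ENNReal.ofReal p) P) m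
  · exact le_iSup₂ (f := fun k (_ : 1 ≤ k) => eLpNorm (ξ k) (ENNReal.ofReal p) P) (k + 1) (by omega)

theorem eLpNorm_le_naturalFun {Ω : Type*} {mΩ : MeasurableSpace Ω} (P : Measure Ω)
    (ξ : ℕ → Ω → ℝ) (p : ℝ) (k : ℕ) :
    eLpNorm (ξ (k + 1)) (ENNReal.ofReal p) P ≤ naturalFun P ξ p :=
  le_iSup₂ (f := fun k (_ : 1 ≤ k) => eLpNorm (ξ k) (ENNReal.ofReal p) P) (k + 1) (by omega)

/-- Supplies the lower bound on `(1, 2]` without continuity: the value at 1 serves. -/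
theorem naturalFun_mono {Ω : Type*} {mΩ : MeasurableSpace Ω} {P : Measure Ω}
    [IsProbabilityMeasure P] {ξ : ℕ → Ω → ℝ} (hξ : ∀ k, AEStronglyMeasurable (ξ (k + 1)) P) :
    Monotone (naturalFun P ξ) := by
  refine fun p q hpq => iSup₂_mono fun k hk => ?_
  obtain ⟨m, rfl⟩ : ∃ m, k = m + 1 := ⟨k - 1, by omega⟩
  exact eLpNorm_le_eLpNorm_of_exponent_le (ENNReal.ofReal_le_ofReal hpq) (hξ m)

theorem uniformTail_eq_zero {Ω : Type*} {mΩ : MeasurableSpace Ω} {P : Measure Ω}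
    {ξ : ℕ → Ω → ℝ} (hξ : ∀ k, ξ (k + 1) =ᵐ[P] 0) {x : ℝ} (hx : 0 < x) :
    uniformTail P ξ x = 0 := by
  refine le_antisymm (iSup₂_le fun n _ => ?_) zero_le
  have h : ∀ᵐ ω ∂P, ∀ k, ξ (k + 1) ω = 0 := ae_all_iff.2 hξ
  refine le_of_eq (measure_mono_null (fun ω hω => ?_) h)
  intro h0
  have : normedSum ξ n ω = 0 := by
    rw [normedSum, Finset.sum_eq_zero, mul_zero]
    intro k hk
    obtain ⟨m, rfl⟩ : ∃ m, k = m + 1 := ⟨k - 1, by have := (Finset.mem_Icc.1 hk).1; omega⟩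
    exact h0 m
  rw [mem_ofPred_eq, this, abs_zero] at hω
  linarith

theorem exists_uniformTail_le_of_naturalFun {r : ℝ} (hr : 2 < r) (law : Measure (ℕ → ℝ)) :
    ∃ C : ℝ, 0 < C ∧
      ∀ (Ω : Type u) (mΩ : MeasurableSpace Ω) (P : Measure Ω) (_ : IsProbabilityMeasure P)
        (ℱ : Filtration ℕ mΩ) (ξ : ℕ → Ω → ℝ), IsMartingaleDifferenceSeq P ℱ ξ →
        P.map (fun ω k => ξ (k + 1) ω) = law →
        (∀ p ∈ Ico 1 r, naturalFun P ξ p < ∞) →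
        ∀ x : ℝ, 0 < x →
          uniformTail P ξ x ≤ ENNReal.ofReal C * tailTransform r (naturalFun P ξ) x := by
  have hA := one_le_momentConst (R := r) (by linarith)
  set v : ℝ → ℝ≥0∞ := fun p =>
    ⨆ k : ℕ, eLpNorm (fun f : ℕ → ℝ => f k) (ENNReal.ofReal p) law with hv
  have hnat : ∀ (Ω : Type u) (mΩ : MeasurableSpace Ω) (P : Measure Ω)
      (ℱ : Filtration ℕ mΩ) (ξ : ℕ → Ω → ℝ), IsMartingaleDifferenceSeq P ℱ ξ →
        P.map (fun ω k => ξ (k + 1) ω) = law → ∀ p, naturalFun P ξ p = v p := by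
    intro Ω mΩ P ℱ ξ h hl p
    rw [naturalFun_eq_iSup_map (fun k => (h.integrable k).1.aemeasurable), hl]
  have h1r : (1 : ℝ) ∈ Ico 1 r := ⟨le_rfl, by linarith⟩
  have hp₀ : (2 + r) / 2 ∈ Ico 1 r := ⟨by linarith, by linarith⟩
  -- If `v 1 = 0`, all differences vanish almost surely and the left side is zero, so any constant
  -- works.
  by_cases h0 : v 1 = 0
  · refine ⟨1, one_pos, fun Ω mΩ P _ ℱ ξ h hl hfin x hx => ?_⟩
    rw [uniformTail_eq_zero (fun k => ?_) hx]
    · exact zero_le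
    · have := eLpNorm_le_naturalFun P ξ 1 k
      rw [hnat Ω mΩ P ℱ ξ h hl, h0, nonpos_iff_eq_zero] at this
      exact (eLpNorm_eq_zero_iff (h.integrable k).1 (by simp)).1 this
  -- Here the finiteness hypothesis fails for every sequence with this law, and any constant works.
  by_cases ht : v 1 = ∞ ∨ v ((2 + r) / 2) = ∞
  · refine ⟨1, one_pos, fun Ω mΩ P _ ℱ ξ h hl hfin x hx => ?_⟩
    have h1 := (hfin _ h1r).ne
    have h2 := (hfin _ hp₀).ne
    rw [hnat Ω mΩ P ℱ ξ h hl] at h1 h2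
    exact absurd ht (by tauto)
  push Not at ht
  have hc : 0 < min 1 (v 1).toReal := lt_min one_pos (ENNReal.toReal_pos h0 ht.1)
  -- The summand 1 gives positivity directly, since `law` is an arbitrary measure at this point.
  have hW : 0 < (v ((2 + r) / 2)).toReal + 1 := by positivity
  refine ⟨(momentConst r * 1) ^ r +
      ((momentConst r * (1 * ((v ((2 + r) / 2)).toReal + 1))) ^ ((2 + r) / 2) + 1) /
        min 1 (v 1).toReal ^ 2, by positivity, fun Ω mΩ P _ ℱ ξ h hl hfin x hx => ?_⟩
  · have hm := naturalFun_mono (P := P) (fun k => (h.integrable k).1)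
    have hge : ∀ p, 1 ≤ p → v 1 ≤ naturalFun P ξ p := fun p hp =>
      (hnat Ω mΩ P ℱ ξ h hl 1).ge.trans (hm hp)
    refine h.uniformTail_le_tailTransform hr le_rfl hc (min_le_left _ _) hW
      (fun p hp => (pos_iff_ne_zero.2 h0).trans_le (hge p (by linarith [hp.1])))
      (fun p hp => hfin p ⟨by linarith [hp.1], hp.2⟩) (fun p hp => ?_) ?_ (fun p hp k => ?_) hx
    · refine le_trans ?_ (hge p hp.1.le)
      calc ENNReal.ofReal (min 1 (v 1).toReal) ≤ ENNReal.ofReal (v 1).toReal :=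
            ENNReal.ofReal_le_ofReal (min_le_right _ _)
        _ = v 1 := ENNReal.ofReal_toReal ht.1
    · rw [hnat Ω mΩ P ℱ ξ h hl]
      calc v ((2 + r) / 2) = ENNReal.ofReal (v ((2 + r) / 2)).toReal :=
            (ENNReal.ofReal_toReal ht.2).symm
        _ ≤ _ := ENNReal.ofReal_le_ofReal (by linarith)
    · rw [ENNReal.ofReal_one, one_mul]
      exact eLpNorm_le_naturalFun P ξ p k

/-! ### Slowly varying functions -/

/-- If all increments `f (u + a) - f u` of a continuous function tend to zero as `u → ∞`, then the
increments over `[0, ∞)` grow at most linearly. -/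
theorem exists_abs_increment_le {f : ℝ → ℝ} (hf : Continuous f)
    (h : ∀ a, Tendsto (fun u => f (u + a) - f u) atTop (𝓝 0)) :
    ∃ B : ℝ, 0 ≤ B ∧ ∀ u v, 0 ≤ u → 0 ≤ v → |f (u + v) - f u| ≤ B * (1 + v) := by
  let F : ℕ → Set ℝ := fun N => {a | ∀ u : ℝ, N ≤ u → |f (u + a) - f u| ≤ 1}
  have hF : ∀ N, IsClosed (F N) := fun N => by
    have : F N = ⋂ (u : ℝ) (_ : (N : ℝ) ≤ u), {a | |f (u + a) - f u| ≤ 1} := by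
      ext a
      simp [F]
    rw [this]
    exact isClosed_iInter fun u => isClosed_iInter fun _ =>
      isClosed_le (by fun_prop) continuous_const
  have hFU : ⋃ N, F N = univ := by
    refine eq_univ_of_forall fun a => mem_iUnion.2 ?_
    have h1 : ∀ᶠ u in atTop, |f (u + a) - f u| < 1 := by
      have := (h a).abs
      rw [abs_zero] at this
      exact this.eventually (gt_mem_nhds one_pos)
    obtain ⟨u₀, hu₀⟩ := eventually_atTop.1 h1
    obtain ⟨N, hN⟩ := exists_nat_ge u₀
    exact ⟨N, fun u hu => (hu₀ u (hN.trans hu)).le⟩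
  -- Baire category: the closed sets `F N` cover the line, so one contains a ball around some `c`.
  -- On it the increments from any `u ≥ N` are bounded by 1.
  obtain ⟨N, c, hc⟩ := nonempty_interior_of_iUnion_of_closed hF hFU
  obtain ⟨ε, hε, hball⟩ := Metric.isOpen_iff.1 isOpen_interior c hc
  have hball' : ∀ w, 0 ≤ w → w < ε → c + w ∈ F N := fun w hw hwε =>
    interior_subset (hball (by
      rw [Metric.mem_ball, Real.dist_eq, add_sub_cancel_left, abs_of_nonneg hw]
      exact hwε))
  set M := max (N + c) 0 with hM
  have hM0 : 0 ≤ M := le_max_right _ _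
  -- The increments by `c + w` and by `c` from the common base `u - c` are subtracted, which moves
  -- the ball to the origin.
  have hstep : ∀ u w, M ≤ u → 0 ≤ w → w < ε → |f (u + w) - f u| ≤ 2 := by
    intro u w hu hw hwε
    have hu' : (N : ℝ) ≤ u - c := by linarith [le_max_left (N + c) 0]
    have h1 := hball' w hw hwε (u - c) hu'
    have h2 := hball' 0 le_rfl hε (u - c) hu'
    rw [show u - c + (c + w) = u + w by ring] at h1
    rw [show u - c + (c + 0) = u by ring] at h2
    rw [abs_le] at *
    constructor <;> linarith
  set η := ε / 2 with hη
  have hη0 : 0 < η := by positivity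
  -- Chaining with steps of length `ε/2`, strictly below `ε` as `hstep` requires.
  have hchain : ∀ k : ℕ, ∀ u v, M ≤ u → 0 ≤ v → v ≤ k * η → |f (u + v) - f u| ≤ 2 * k := by
    intro k
    induction k with
    | zero =>
      intro u v _ hv0 hv
      have : v = 0 := le_antisymm (by simpa using hv) hv0
      simp [this]
    | succ k ih =>
      intro u v hu hv0 hv
      push_cast at hv ⊢
      have hw : 0 ≤ min v η := le_min hv0 hη0.le
      have h1 := hstep u (min v η) hu hw ((min_le_right _ _).trans_lt (by linarith))
      have h2 := ih (u + min v η) (v - min v η) (by linarith)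
        (by linarith [min_le_left v η]) (by
          rcases le_total v η with h | h
          · rw [min_eq_left h]; simp; positivity
          · rw [min_eq_right h]; linarith)
      rw [show u + min v η + (v - min v η) = u + v by ring] at h2
      rw [abs_le] at *
      constructor <;> linarith
  have hlin : ∀ u v, M ≤ u → 0 ≤ v → |f (u + v) - f u| ≤ 2 * (v / η + 1) := by
    intro u v hu hv
    have h1 := hchain ⌈v / η⌉₊ u v hu hv (by
      rw [← div_le_iff₀ hη0]
      exact Nat.le_ceil _)
    have h2 := (Nat.ceil_lt_add_one (by positivity : 0 ≤ v / η)).le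
    linarith
  -- Starting points below `M` are handled by compactness.
  obtain ⟨Q, hQ⟩ := isCompact_Icc.exists_bound_of_continuousOn (s := Icc 0 M) hf.continuousOn
  have hQ0 : 0 ≤ Q := (norm_nonneg _).trans (hQ 0 ⟨le_rfl, hM0⟩)
  refine ⟨2 / η + 2 + 2 * Q, by positivity, fun u v hu hv => ?_⟩
  have e : (2 / η + 2 + 2 * Q) * (1 + v) =
    2 * (v / η + 1) + 2 * Q + (2 / η + 2 * v + 2 * Q * v) := by ring
  have e0 : 0 ≤ 2 / η + 2 * v + 2 * Q * v := by positivity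
  have e1 : 0 ≤ 2 * (v / η + 1) := by positivity
  rw [e]
  rcases le_total M u with hMu | hMu
  · linarith [hlin u v hMu hv]
  · have h1 := hQ u ⟨hu, hMu⟩
    rcases le_total M (u + v) with hMv | hMv
    · have h2 := hlin M (u + v - M) le_rfl (by linarith)
      have h3 := hQ M ⟨hM0, le_rfl⟩
      rw [add_sub_cancel] at h2
      have h4 : 2 * ((u + v - M) / η + 1) ≤ 2 * (v / η + 1) := by
        gcongr
        linarith
      rw [Real.norm_eq_abs] at h1 h3
      rw [abs_le] at *
      constructor <;> linarith
    · have h2 := hQ (u + v) ⟨by linarith, hMv⟩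
      rw [Real.norm_eq_abs] at h1 h2
      rw [abs_le] at *
      constructor <;> linarith

/-- In the variable `u = log t`, slow variation says that increments of `log L(e^u)` tend to zero.
The `max u 0` extends this function continuously to the whole line. -/
theorem IsSlowlyVarying.exists_abs_log_sub_le {L : ℝ → ℝ} (hL : IsSlowlyVarying L) :
    ∃ B : ℝ, 0 ≤ B ∧ ∀ s t, 1 ≤ s → s ≤ t →
      |Real.log (L t) - Real.log (L s)| ≤ B * (1 + (Real.log t - Real.log s)) := by
  have hmax : ∀ u : ℝ, 1 ≤ Real.exp (max u 0) := fun u => Real.one_le_exp (le_max_right _ _)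
  have hcont : Continuous fun u => Real.log (L (Real.exp (max u 0))) := by
    have hc : Continuous fun u : ℝ => L (Real.exp (max u 0)) :=
      hL.continuousOn.comp_continuous (by fun_prop) hmax
    exact hc.log fun u => (hL.pos _ (hmax u)).ne'
  have hlim : ∀ a, Tendsto (fun u => Real.log (L (Real.exp (max (u + a) 0))) -
      Real.log (L (Real.exp (max u 0)))) atTop (𝓝 0) := by
    intro a
    have h1 := (hL.tendsto_ratio (Real.exp a) (Real.exp_pos a)).comp Real.tendsto_exp_atTop
    have h2 := (Real.continuousAt_log one_ne_zero).tendsto.comp h1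
    rw [Real.log_one] at h2
    refine h2.congr' ?_
    filter_upwards [eventually_ge_atTop 0, eventually_ge_atTop (-a)] with u hu hua
    have hua' : 0 ≤ u + a := by linarith
    simp only [Function.comp]
    rw [max_eq_left hu, max_eq_left hua', ← Real.exp_add, add_comm a u, Real.log_div]
    · exact (hL.pos _ (Real.one_le_exp hua')).ne'
    · exact (hL.pos _ (Real.one_le_exp hu)).ne'
  obtain ⟨B, hB0, hB⟩ := exists_abs_increment_le hcont hlim
  refine ⟨B, hB0, fun s t hs hst => ?_⟩
  have hs0 : 0 < s := by linarith
  have ht0 : 0 < t := by linarith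
  have h := hB (Real.log s) (Real.log t - Real.log s) (Real.log_nonneg hs)
    (sub_nonneg.2 (Real.log_le_log hs0 hst))
  rwa [add_sub_cancel, max_eq_left (Real.log_nonneg hs),
    max_eq_left (Real.log_nonneg (hs.trans hst)), Real.exp_log hs0, Real.exp_log ht0] at h

/-- A weak form of Potter's bounds for the regularly varying function `t ^ γ * L t`. -/
theorem IsSlowlyVarying.exists_rpow_mul_le {L : ℝ → ℝ} (hL : IsSlowlyVarying L) (γ : ℝ) {δ : ℝ}
    (hδ : 0 < δ) : ∃ D : ℝ, 0 < D ∧ ∀ s t, 1 ≤ s → 1 ≤ t →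
      t ^ γ * L t ≤ D * (s ^ γ * L s) * Real.exp (δ * |t - s|) := by
  obtain ⟨B, hB0, hB⟩ := hL.exists_abs_log_sub_le
  set E := B + |γ| + 1 with hE
  have hE0 : 0 < E := by positivity
  set Q := B + (δ - E - E * Real.log (δ / E)) with hQ
  have hlog : ∀ t, 1 ≤ t → Real.log (t ^ γ * L t) = γ * Real.log t + Real.log (L t) := by
    intro t ht
    have ht0 : 0 < t := by linarith
    rw [Real.log_mul (by positivity) (hL.pos t ht).ne', Real.log_rpow ht0]
  have key : ∀ s t, 1 ≤ s → s ≤ t →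
      |Real.log (t ^ γ * L t) - Real.log (s ^ γ * L s)| ≤ Q + δ * (t - s) := by
    intro s t hs hst
    have hs0 : 0 < s := by linarith
    have ht0 : 0 < t := by linarith
    set y := Real.log t - Real.log s with hy
    have hy0 : 0 ≤ y := sub_nonneg.2 (Real.log_le_log hs0 hst)
    have h1 : |Real.log (t ^ γ * L t) - Real.log (s ^ γ * L s)| ≤ B + E * y := by
      rw [hlog t (hs.trans hst), hlog s hs]
      have h2 := hB s t hs hst
      have h3 : |γ * y| ≤ |γ| * y := by rw [abs_mul, abs_of_nonneg hy0]
      rw [← hy] at h2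
      have h4 : γ * Real.log t + Real.log (L t) - (γ * Real.log s + Real.log (L s)) =
        γ * y + (Real.log (L t) - Real.log (L s)) := by rw [hy]; ring
      rw [h4]
      refine (abs_add_le _ _).trans ?_
      rw [hE]
      nlinarith
    -- Uses `s ≥ 1`: `t ≤ s (1 + t - s)` is `(s - 1)(t - s) ≥ 0`. This turns a power of `t/s` into a
    -- quantity depending on `t - s`.
    have h5 : y ≤ Real.log (1 + (t - s)) := by
      rw [hy, ← Real.log_div ht0.ne' hs0.ne']
      refine Real.log_le_log (by positivity) ?_
      rw [div_le_iff₀ hs0]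
      nlinarith
    -- A logarithm is traded for an arbitrarily small linear slope: `log z ≤ z - 1` at `z = (δ/E)(1
    -- + t - s)`.
    have hts : 0 < 1 + (t - s) := by linarith
    have h6 : Real.log (δ / E) + Real.log (1 + (t - s)) ≤ δ / E * (1 + (t - s)) - 1 := by
      rw [← Real.log_mul (by positivity) hts.ne']
      exact Real.log_le_sub_one_of_pos (by positivity)
    have h7 : E * y ≤ E * (δ / E * (1 + (t - s)) - 1 - Real.log (δ / E)) :=
      mul_le_mul_of_nonneg_left (by linarith) hE0.le
    have h8 : E * (δ / E * (1 + (t - s)) - 1 - Real.log (δ / E)) =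
        δ * (1 + (t - s)) - E - E * Real.log (δ / E) := by field_simp
    rw [hQ]
    linarith
  have key' : ∀ s t, 1 ≤ s → 1 ≤ t →
      Real.log (t ^ γ * L t) ≤ Q + Real.log (s ^ γ * L s) + δ * |t - s| := by
    intro s t hs ht
    rcases le_total s t with h | h
    · have := (abs_le.1 (key s t hs h)).2
      rw [abs_of_nonneg (by linarith)]
      linarith
    · have := (abs_le.1 (key t s ht h)).1
      rw [abs_of_nonpos (by linarith)]
      linarith
  have hpos : ∀ t, 1 ≤ t → 0 < t ^ γ * L t := fun t ht =>
    mul_pos (Real.rpow_pos_of_pos (by linarith) γ) (hL.pos t ht)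
  refine ⟨Real.exp Q, Real.exp_pos Q, fun s t hs ht => ?_⟩
  have h := Real.exp_le_exp.2 (key' s t hs ht)
  rwa [Real.exp_add, Real.exp_add, Real.exp_log (hpos t ht), Real.exp_log (hpos s hs)] at h

/-! ### Moments of truncations from tail bounds -/

theorem lintegral_Ioc_ofReal_rpow {q x : ℝ} (hq : -1 < q) (hx : 0 ≤ x) :
    ∫⁻ t in Ioc 0 x, ENNReal.ofReal (t ^ q) = ENNReal.ofReal (x ^ (q + 1) / (q + 1)) := by
  have hint : IntegrableOn (fun t : ℝ => t ^ q) (Ioc 0 x) :=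
    (intervalIntegrable_iff_integrableOn_Ioc_of_le hx).1
      (intervalIntegral.intervalIntegrable_rpow' hq)
  rw [← ofReal_integral_eq_lintegral_ofReal hint, ← intervalIntegral.integral_of_le hx,
    integral_rpow (Or.inl hq), Real.zero_rpow (by linarith), sub_zero]
  exact (ae_restrict_mem measurableSet_Ioc).mono fun t ht => Real.rpow_nonneg ht.1.le q

theorem lintegral_Ioi_ofReal_rpow {q x : ℝ} (hq : q < -1) (hx : 0 < x) :
    ∫⁻ t in Ioi x, ENNReal.ofReal (t ^ q) = ENNReal.ofReal (-x ^ (q + 1) / (q + 1)) := by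
  rw [← ofReal_integral_eq_lintegral_ofReal (integrableOn_Ioi_rpow_of_lt hq hx),
    integral_Ioi_rpow_of_lt hq hx]
  exact (ae_restrict_mem measurableSet_Ioi).mono fun t ht => Real.rpow_nonneg (hx.trans ht).le q

section Moments

variable {Ω : Type*} {mΩ : MeasurableSpace Ω} {P : Measure Ω} {η : Ω → ℝ}

theorem eLpNorm_le_of_lintegral_le {p B : ℝ} (hp : 0 < p) (hB : 0 ≤ B)
    (h : ∫⁻ ω, ENNReal.ofReal (|η ω| ^ p) ∂P ≤ ENNReal.ofReal B) :
    eLpNorm η (ENNReal.ofReal p) P ≤ ENNReal.ofReal (B ^ p⁻¹) := by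
  rw [eLpNorm_eq_lintegral_rpow_enorm_toReal (by simpa using hp) ENNReal.ofReal_ne_top,
    ENNReal.toReal_ofReal hp.le, ← ENNReal.ofReal_rpow_of_nonneg hB (by positivity), one_div]
  refine ENNReal.rpow_le_rpow (le_trans (le_of_eq ?_) h) (by positivity)
  refine lintegral_congr fun ω => ?_
  rw [Real.enorm_eq_ofReal_abs, ENNReal.ofReal_rpow_of_nonneg (abs_nonneg _) hp.le]

/-- A power bound for the tail up to the level `x` bounds the moments of the truncation. -/
theorem eLpNorm_truncation_le {a q B x : ℝ} (hη : AEMeasurable η P) (hq : 0 < q)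
    (haq : a < q) (hB : 0 ≤ B) (hx : 0 < x)
    (h : ∀ t, 0 < t → t ≤ x → tailFun P η t ≤ ENNReal.ofReal (B * t ^ (-a))) :
    eLpNorm ({ω | |η ω| ≤ x}.indicator η) (ENNReal.ofReal q) P ≤
      ENNReal.ofReal ((q * B * x ^ (q - a) / (q - a)) ^ q⁻¹) := by
  have hqa : 0 < q - a := sub_pos.2 haq
  have hset : NullMeasurableSet {ω | |η ω| ≤ x} P := nullMeasurableSet_le hη.abs aemeasurable_const
  have hm : AEMeasurable ({ω | |η ω| ≤ x}.indicator η) P := hη.indicator₀ hset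
  refine eLpNorm_le_of_lintegral_le hq (by positivity) ?_
  rw [lintegral_rpow_eq_lintegral_meas_le_mul P (ae_of_all _ fun _ => abs_nonneg _) hm.abs hq]
  -- In the layer-cake integral the layers above `x` are empty; convergence at 0 is due to `a < q`.
  have hle : ∫⁻ t in Ioi 0, P {ω | t ≤ |{ω | |η ω| ≤ x}.indicator η ω|} *
      ENNReal.ofReal (t ^ (q - 1)) ≤
      ∫⁻ t in Ioc 0 x, ENNReal.ofReal B * ENNReal.ofReal (t ^ (q - a - 1)) := by
    rw [← lintegral_indicator measurableSet_Ioi, ← lintegral_indicator measurableSet_Ioc]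
    refine lintegral_mono fun t => ?_
    by_cases ht : 0 < t
    swap
    · simp [indicator_of_notMem (show t ∉ Ioi (0 : ℝ) from ht)]
    rw [indicator_of_mem (show t ∈ Ioi (0 : ℝ) from ht)]
    by_cases htx : t ≤ x
    · rw [indicator_of_mem (show t ∈ Ioc 0 x from ⟨ht, htx⟩), ← ENNReal.ofReal_mul hB]
      have h1 : P {ω | t ≤ |{ω | |η ω| ≤ x}.indicator η ω|} ≤ tailFun P η t := by
        refine measure_mono fun ω hω => ?_
        rw [mem_ofPred_eq] at hω ⊢
        by_cases hωx : ω ∈ {ω | |η ω| ≤ x}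
        · rwa [indicator_of_mem hωx] at hω
        · rw [indicator_of_notMem hωx, abs_zero] at hω
          linarith
      calc _ ≤ ENNReal.ofReal (B * t ^ (-a)) * ENNReal.ofReal (t ^ (q - 1)) := by
            gcongr
            exact h1.trans (h t ht htx)
        _ = _ := by
            rw [← ENNReal.ofReal_mul (by positivity), mul_assoc, ← Real.rpow_add ht]
            congr 3
            ring
    · have h1 : {ω | t ≤ |{ω | |η ω| ≤ x}.indicator η ω|} = ∅ := by
        refine eq_empty_of_forall_notMem fun ω hω => ?_
        rw [mem_ofPred_eq] at hω
        by_cases hωx : ω ∈ {ω | |η ω| ≤ x}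
        · rw [indicator_of_mem hωx] at hω
          exact htx (hω.trans hωx)
        · rw [indicator_of_notMem hωx, abs_zero] at hω
          linarith
      rw [h1, measure_empty, zero_mul]
      exact zero_le
  calc _ ≤ ENNReal.ofReal q *
        ∫⁻ t in Ioc 0 x, ENNReal.ofReal B * ENNReal.ofReal (t ^ (q - a - 1)) := by gcongr
    _ = _ := by
      rw [lintegral_const_mul' _ _ ENNReal.ofReal_ne_top,
        lintegral_Ioc_ofReal_rpow (by linarith) hx.le, ← ENNReal.ofReal_mul hB,
        ← ENNReal.ofReal_mul hq.le, sub_add_cancel]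
      congr 1
      ring

/-- A power bound for the tail beyond the level `x` bounds the second moment of the remainder of
the truncation. -/
theorem eLpNorm_remainder_le {b B x : ℝ} (hη : AEMeasurable η P) (hb : 2 < b) (hB : 0 ≤ B)
    (hx : 0 < x) (h : ∀ t, x ≤ t → tailFun P η t ≤ ENNReal.ofReal (B * t ^ (-b))) :
    eLpNorm ({ω | x < |η ω|}.indicator η) (ENNReal.ofReal 2) P ≤
      ENNReal.ofReal ((B * x ^ (2 - b) * (1 + 2 / (b - 2))) ^ (2 : ℝ)⁻¹) := by
  have hb0 : 0 < b - 2 := sub_pos.2 hb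
  have hset : NullMeasurableSet {ω | x < |η ω|} P := nullMeasurableSet_lt aemeasurable_const hη.abs
  have hm : AEMeasurable ({ω | x < |η ω|}.indicator η) P := hη.indicator₀ hset
  refine eLpNorm_le_of_lintegral_le two_pos (by positivity) ?_
  rw [lintegral_rpow_eq_lintegral_meas_le_mul P (ae_of_all _ fun _ => abs_nonneg _) hm.abs two_pos]
  -- Layers below `x` only see the event `|η| > x`, hence the tail at `max t x`; beyond `x`
  -- convergence is due to `b > 2`.
  have hmono : ∀ t, 0 < t → P {ω | t ≤ |{ω | x < |η ω|}.indicator η ω|} ≤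
      tailFun P η (max t x) := by
    refine fun t ht => measure_mono fun ω hω => ?_
    rw [mem_ofPred_eq] at hω ⊢
    by_cases hωx : ω ∈ {ω | x < |η ω|}
    · rw [indicator_of_mem hωx] at hω
      exact max_le hω (le_of_lt hωx)
    · rw [indicator_of_notMem hωx, abs_zero] at hω
      linarith
  have h1 : ∫⁻ t in Ioc 0 x, P {ω | t ≤ |{ω | x < |η ω|}.indicator η ω|} *
      ENNReal.ofReal (t ^ ((2 : ℝ) - 1)) ≤
      ∫⁻ t in Ioc 0 x, ENNReal.ofReal (B * x ^ (-b)) * ENNReal.ofReal (t ^ ((2 : ℝ) - 1)) := by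
    refine setLIntegral_mono' measurableSet_Ioc fun t ht => ?_
    gcongr
    refine (hmono t ht.1).trans ?_
    rw [max_eq_right ht.2]
    exact h x le_rfl
  have h2 : ∫⁻ t in Ioi x, P {ω | t ≤ |{ω | x < |η ω|}.indicator η ω|} *
      ENNReal.ofReal (t ^ ((2 : ℝ) - 1)) ≤
      ∫⁻ t in Ioi x, ENNReal.ofReal B * ENNReal.ofReal (t ^ (1 - b)) := by
    refine setLIntegral_mono' measurableSet_Ioi fun t ht => ?_
    have ht0 : 0 < t := hx.trans ht
    calc _ ≤ ENNReal.ofReal (B * t ^ (-b)) * ENNReal.ofReal (t ^ ((2 : ℝ) - 1)) := by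
          gcongr
          refine (hmono t ht0).trans ?_
          rw [max_eq_left (le_of_lt ht)]
          exact h t (le_of_lt ht)
      _ = _ := by
          rw [← ENNReal.ofReal_mul (by positivity), ← ENNReal.ofReal_mul hB, mul_assoc,
            ← Real.rpow_add ht0]
          congr 3
          ring
  have hsplit : Ioi (0 : ℝ) = Ioc 0 x ∪ Ioi x := (Ioc_union_Ioi_eq_Ioi hx.le).symm
  rw [hsplit, lintegral_union measurableSet_Ioi (by
    rw [Set.disjoint_left]
    exact fun t ht ht' => absurd ht.2 (not_le.2 ht'))]
  calc _ ≤ ENNReal.ofReal 2 * (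
        (∫⁻ t in Ioc 0 x, ENNReal.ofReal (B * x ^ (-b)) * ENNReal.ofReal (t ^ ((2 : ℝ) - 1))) +
        ∫⁻ t in Ioi x, ENNReal.ofReal B * ENNReal.ofReal (t ^ (1 - b))) := by gcongr
    _ = _ := by
      have e1 : -x ^ (1 - b + 1) / (1 - b + 1) = x ^ (2 - b) / (b - 2) := by
        rw [show 1 - b + 1 = 2 - b by ring, ← neg_sub b 2, neg_div_neg_eq]
      have e2 : x ^ (2 - b) = x ^ (-b) * x ^ (2 : ℝ) := by
        rw [← Real.rpow_add hx]
        congr 1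
        ring
      rw [lintegral_const_mul' _ _ ENNReal.ofReal_ne_top,
        lintegral_const_mul' _ _ ENNReal.ofReal_ne_top,
        lintegral_Ioc_ofReal_rpow (by norm_num) hx.le, lintegral_Ioi_ofReal_rpow (by linarith) hx,
        e1, ← ENNReal.ofReal_mul (by positivity), ← ENNReal.ofReal_mul hB,
        ← ENNReal.ofReal_add (by positivity) (by positivity), ← ENNReal.ofReal_mul (by positivity),
        sub_add_cancel, e2]
      congr 1
      field_simp

end Moments

/-! ### Truncation of martingale differences -/

/-- Conditional expectation contracts `L^p`, so recentring costs a factor of at most 2. -/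
theorem eLpNorm_sub_condExp_le {Ω : Type*} {m mΩ : MeasurableSpace Ω} {P : Measure Ω}
    [IsProbabilityMeasure P] {η : Ω → ℝ} {p s : ℝ} (hp : 1 ≤ p) (hη : AEStronglyMeasurable η P) (hs : 0 ≤ s)
    (h : eLpNorm η (ENNReal.ofReal p) P ≤ ENNReal.ofReal s) :
    eLpNorm (η - P[η | m]) (ENNReal.ofReal p) P ≤ ENNReal.ofReal (2 * s) := by
  have hp' : 1 ≤ ENNReal.ofReal p := by simpa using hp
  calc _ ≤ eLpNorm η (ENNReal.ofReal p) P + eLpNorm (P[η | m]) (ENNReal.ofReal p) P :=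
        eLpNorm_sub_le hη integrable_condExp.1 hp'
    _ ≤ ENNReal.ofReal s + ENNReal.ofReal s :=
        add_le_add h ((eLpNorm_condExp_le_eLpNorm η hp').trans h)
    _ = _ := by rw [← ENNReal.ofReal_add hs hs, two_mul]

namespace IsMartingaleDifferenceSeq

variable {Ω : Type*} {mΩ : MeasurableSpace Ω} {P : Measure Ω} {ℱ : Filtration ℕ mΩ}
  {ξ : ℕ → Ω → ℝ}

theorem sub {ξ' : ℕ → Ω → ℝ} (h : IsMartingaleDifferenceSeq P ℱ ξ)
    (h' : IsMartingaleDifferenceSeq P ℱ ξ') : IsMartingaleDifferenceSeq P ℱ (ξ - ξ') where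
  initial := h.initial
  adapted k := (h.adapted k).sub (h'.adapted k)
  integrable k := (h.integrable k).sub (h'.integrable k)
  condExp_eq_zero k := by
    filter_upwards [condExp_sub (h.integrable k) (h'.integrable k) (ℱ k), h.condExp_eq_zero k,
      h'.condExp_eq_zero k] with ω h1 h2 h3
    rw [Pi.sub_apply ξ ξ', h1, Pi.sub_apply, h2, h3]
    simp

/-- The truncated and recentred martingale differences. -/
noncomputable def _root_.recentredTruncation (P : Measure Ω) (ℱ : Filtration ℕ mΩ) (ξ : ℕ → Ω → ℝ) (x : ℝ)
    (k : ℕ) : Ω → ℝ :=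
  {ω | |ξ k ω| ≤ x}.indicator (ξ k) - P[{ω | |ξ k ω| ≤ x}.indicator (ξ k) | ℱ (k - 1)]

theorem measurableSet_abs_le (h : IsMartingaleDifferenceSeq P ℱ ξ) (x : ℝ) (k : ℕ) :
    MeasurableSet[ℱ (k + 1)] {ω | |ξ (k + 1) ω| ≤ x} :=
  (h.adapted k).norm.measurableSet_le stronglyMeasurable_const

theorem integrable_truncation (h : IsMartingaleDifferenceSeq P ℱ ξ) (x : ℝ) (k : ℕ) :
    Integrable ({ω | |ξ (k + 1) ω| ≤ x}.indicator (ξ (k + 1))) P :=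
  (h.integrable k).indicator (ℱ.le _ _ (h.measurableSet_abs_le x k))

/-- The truncation event at time `k + 1` belongs to `ℱ (k + 1)`, so adaptedness survives;
subtracting the conditional expectation restores the centring that truncation destroys. -/
theorem truncation [IsProbabilityMeasure P] (h : IsMartingaleDifferenceSeq P ℱ ξ) (x : ℝ) :
    IsMartingaleDifferenceSeq P ℱ (recentredTruncation P ℱ ξ x) where
  initial := h.initial
  adapted k := ((h.adapted k).indicator (h.measurableSet_abs_le x k)).sub
    (stronglyMeasurable_condExp.mono (ℱ.mono (Nat.le_succ k)))
  integrable k := (h.integrable_truncation x k).sub integrable_condExp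
  condExp_eq_zero k := by
    have h1 := condExp_sub (h.integrable_truncation x k)
      (integrable_condExp (μ := P) (m := ℱ k)
        (f := {ω | |ξ (k + 1) ω| ≤ x}.indicator (ξ (k + 1)))) (ℱ k)
    rw [condExp_of_stronglyMeasurable (ℱ.le k) stronglyMeasurable_condExp integrable_condExp] at h1
    refine h1.trans (ae_of_all _ fun ω => ?_)
    simp

/-- The part left over by the truncation is the recentred remainder. -/
theorem sub_recentredTruncation_ae_eq (h : IsMartingaleDifferenceSeq P ℱ ξ) (x : ℝ) (k : ℕ) :
    (ξ - recentredTruncation P ℱ ξ x) (k + 1) =ᵐ[P]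
      {ω | x < |ξ (k + 1) ω|}.indicator (ξ (k + 1)) -
        P[{ω | x < |ξ (k + 1) ω|}.indicator (ξ (k + 1)) | ℱ k] := by
  have hcompl : {ω | x < |ξ (k + 1) ω|} = {ω | |ξ (k + 1) ω| ≤ x}ᶜ := by
    ext ω
    simp
  have hJ : {ω | x < |ξ (k + 1) ω|}.indicator (ξ (k + 1)) =
      ξ (k + 1) - {ω | |ξ (k + 1) ω| ≤ x}.indicator (ξ (k + 1)) := by
    rw [hcompl, indicator_compl]
  filter_upwards [condExp_sub (h.integrable k) (h.integrable_truncation x k) (ℱ k),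
    h.condExp_eq_zero k] with ω h1 h2
  rw [hJ]
  simp only [Pi.sub_apply, recentredTruncation, Nat.add_sub_cancel] at h1 ⊢
  rw [h1, h2, Pi.zero_apply]
  ring

end IsMartingaleDifferenceSeq

theorem tailFun_normedSum_add_le {Ω : Type*} {mΩ : MeasurableSpace Ω} (P : Measure Ω)
    (ξ ξ' : ℕ → Ω → ℝ) (n : ℕ) (x : ℝ) :
    tailFun P (normedSum ξ n) x ≤
      tailFun P (normedSum ξ' n) (x / 2) + tailFun P (normedSum (ξ - ξ') n) (x / 2) := by
  refine le_trans (measure_mono fun ω hω => ?_) (measure_union_le _ _)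
  have e : normedSum ξ n ω = normedSum ξ' n ω + normedSum (ξ - ξ') n ω := by
    simp only [normedSum, ← mul_add, ← Finset.sum_add_distrib, Pi.sub_apply, add_sub_cancel]
  rw [mem_ofPred_eq, e] at hω
  by_contra hcon
  rw [mem_union, mem_ofPred_eq, mem_ofPred_eq] at hcon
  push Not at hcon
  linarith [abs_add_le (normedSum ξ' n ω) (normedSum (ξ - ξ') n ω), hcon.1, hcon.2]

theorem le_uniformTail {Ω : Type*} {mΩ : MeasurableSpace Ω} (P : Measure Ω) (ξ : ℕ → Ω → ℝ)
    {n : ℕ} (hn : 1 ≤ n) (x : ℝ) : tailFun P (normedSum ξ n) x ≤ uniformTail P ξ x :=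
  le_iSup₂ (f := fun n (_ : 1 ≤ n) => tailFun P (normedSum ξ n) x) n hn

namespace IsMartingaleDifferenceSeq

variable {Ω : Type*} {mΩ : MeasurableSpace Ω} {P : Measure Ω} {ℱ : Filtration ℕ mΩ}
  {ξ : ℕ → Ω → ℝ}

/-- The uniform tail at the level `x`, in terms of power bounds for the individual tails below and
above this level. -/
theorem uniformTail_le_of_tailFun_le [IsProbabilityMeasure P]
    (h : IsMartingaleDifferenceSeq P ℱ ξ) {a b q B₁ B₂ x : ℝ} (haq : a < q) (hq : 2 ≤ q)
    (hb : 2 < b) (hB₁ : 0 < B₁) (hB₂ : 0 < B₂) (hx : 0 < x)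
    (h₁ : ∀ k t, 0 < t → t ≤ x → tailFun P (ξ (k + 1)) t ≤ ENNReal.ofReal (B₁ * t ^ (-a)))
    (h₂ : ∀ k t, x ≤ t → tailFun P (ξ (k + 1)) t ≤ ENNReal.ofReal (B₂ * t ^ (-b))) :
    uniformTail P ξ x ≤ ENNReal.ofReal ((4 * momentConst q) ^ q * (q / (q - a)) * (B₁ * x ^ (-a)) +
      (4 * momentConst q) ^ 2 * (1 + 2 / (b - 2)) * (B₂ * x ^ (-b))) := by
  have hA := one_le_momentConst (R := q) (by linarith)
  have hqa : 0 < q - a := sub_pos.2 haq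
  have hb2 : 0 < b - 2 := sub_pos.2 hb
  have hq0 : 0 < q := by linarith
  -- The 4 collects one factor 2 from recentring and one from splitting the level into halves.
  have hsc : ∀ p X : ℝ, 0 < p → 0 < X →
      (momentConst q * (2 * X ^ p⁻¹) / (x / 2)) ^ p = (4 * momentConst q) ^ p * X / x ^ p := by
    intro p X hp hX
    have e : momentConst q * (2 * X ^ p⁻¹) / (x / 2) = 4 * momentConst q * X ^ p⁻¹ / x := by
      field_simp
      ring
    rw [e, Real.div_rpow (by positivity) hx.le, Real.mul_rpow (by positivity) (by positivity),
      ← Real.rpow_mul hX.le, inv_mul_cancel₀ hp.ne', Real.rpow_one]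
  have hX₁ : 0 < q * B₁ * x ^ (q - a) / (q - a) := by positivity
  have hX₂ : 0 < B₂ * x ^ (2 - b) * (1 + 2 / (b - 2)) := by positivity
  have hU₁ := (h.truncation x).uniformTail_le_rpow (x := x / 2)
    (s := 2 * (q * B₁ * x ^ (q - a) / (q - a)) ^ q⁻¹) hq le_rfl (by positivity) (by positivity)
    (fun k => eLpNorm_sub_condExp_le (by linarith) (h.integrable_truncation x k).1 (by positivity)
      (eLpNorm_truncation_le (h.integrable k).1.aemeasurable hq0 haq hB₁.le hx (h₁ k)))
  have hU₂ := (h.sub (h.truncation x)).uniformTail_le_rpow (x := x / 2)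
    (s := 2 * (B₂ * x ^ (2 - b) * (1 + 2 / (b - 2))) ^ (2 : ℝ)⁻¹) le_rfl hq (by positivity)
    (by positivity) (fun k => by
      rw [eLpNorm_congr_ae (h.sub_recentredTruncation_ae_eq x k)]
      refine eLpNorm_sub_condExp_le (by norm_num) ((h.integrable k).1.indicator ?_) (by positivity)
        (eLpNorm_remainder_le (h.integrable k).1.aemeasurable hb hB₂.le hx (h₂ k))
      exact ℱ.le (k + 1) _ (stronglyMeasurable_const.measurableSet_lt (h.adapted k).norm))
  rw [hsc _ _ hq0 hX₁] at hU₁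
  rw [hsc _ _ two_pos hX₂] at hU₂
  have hpow : ∀ p c : ℝ, x ^ (p - c) = x ^ p * x ^ (-c) := fun p c => by
    rw [← Real.rpow_add hx, sub_eq_add_neg]
  refine iSup₂_le fun n hn => ?_
  calc tailFun P (normedSum ξ n) x ≤ _ :=
        tailFun_normedSum_add_le P ξ (recentredTruncation P ℱ ξ x) n x
    _ ≤ _ := add_le_add ((le_uniformTail P _ hn _).trans hU₁) ((le_uniformTail P _ hn _).trans hU₂)
    _ = _ := by
      rw [← ENNReal.ofReal_add (by positivity) (by positivity), hpow, hpow, Real.rpow_two,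
        Real.rpow_two]
      congr 1
      have : 0 < x ^ q := by positivity
      field_simp

end IsMartingaleDifferenceSeq

/-! ### Regularly varying tails -/

theorem regTail_pos {r γ : ℝ} {L : ℝ → ℝ} (hL : IsSlowlyVarying L) {x : ℝ} (hx : Real.exp 1 < x) :
    0 < regTail r γ L x := by
  have hx0 : 0 < x := (Real.exp_pos 1).trans hx
  have hlog : 1 < Real.log x := (Real.lt_log_iff_exp_lt hx0).2 hx
  have hlog0 : 0 < Real.log x := by linarith
  exact mul_pos (by positivity) (hL.pos _ hlog.le)

theorem regTail_le_regTail_add_one {r γ : ℝ} {L : ℝ → ℝ} (hL : IsSlowlyVarying L) {x : ℝ}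
    (hx : Real.exp 1 < x) : regTail r γ L x ≤ regTail r (γ + 1) L x := by
  have hx0 : 0 < x := (Real.exp_pos 1).trans hx
  have hlog : 1 < Real.log x := (Real.lt_log_iff_exp_lt hx0).2 hx
  have e : regTail r (γ + 1) L x = regTail r γ L x * Real.log x := by
    rw [regTail, regTail, Real.rpow_add_one (by linarith)]
    ring
  rw [e]
  exact le_mul_of_one_le_right (regTail_pos hL hx).le hlog.le

/-- For regularly varying tail bounds of order `r > 2`, the uniform tail of the normed sums is of
the same order as the bound for the individual tails. -/
theorem exists_uniformTail_le_regTail {r : ℝ} (hr : 2 < r) (γ : ℝ) {L : ℝ → ℝ}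
    (hL : IsSlowlyVarying L) : ∃ C : ℝ, 0 < C ∧
      ∀ (Ω : Type u) (mΩ : MeasurableSpace Ω) (P : Measure Ω) (_ : IsProbabilityMeasure P)
        (ℱ : Filtration ℕ mΩ) (ξ : ℕ → Ω → ℝ), IsMartingaleDifferenceSeq P ℱ ξ →
        (∀ i : ℕ, 1 ≤ i → ∀ x : ℝ, Real.exp 1 < x →
            tailFun P (ξ i) x ≤ ENNReal.ofReal (regTail r γ L x)) →
          ∀ x : ℝ, Real.exp 1 < x →
            uniformTail P ξ x ≤ ENNReal.ofReal (C * regTail r γ L x) := by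
  -- This choice keeps `r - δ > 2`, as the second moment of the remainder requires; `q` below
  -- exceeds `r + δ` by 1, as the truncated part requires `q > a`.
  set δ := (r - 2) / 2 with hδ
  have hδ0 : 0 < δ := by rw [hδ]; linarith
  obtain ⟨D, hD0, hD⟩ := hL.exists_rpow_mul_le γ hδ0
  have hL1 : 0 < L 1 := hL.pos 1 le_rfl
  set q := r + δ + 1 with hq
  have hA := one_le_momentConst (R := q) (by linarith)
  -- The first summand serves `e < t ≤ x`. The second serves `t ≤ e`, where only the trivial bound 1
  -- is known and the Potter bound compares `log x` with 1.
  set K := D + Real.exp 1 ^ (r + δ) * (D / L 1) with hK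
  have hK0 : 0 < K := by positivity
  have hq0 : 0 < q := by linarith
  have hqr : q - (r + δ) = 1 := by rw [hq]; ring
  have hrδ : 0 < r - δ - 2 := by rw [hδ]; linarith
  refine ⟨(4 * momentConst q) ^ q * (q / (q - (r + δ))) * K +
    (4 * momentConst q) ^ 2 * (1 + 2 / (r - δ - 2)) * D, by rw [hqr]; positivity,
    fun Ω mΩ P _ ℱ ξ h hξ x hx => ?_⟩
  have hx0 : 0 < x := (Real.exp_pos 1).trans hx
  have hlog : 1 < Real.log x := (Real.lt_log_iff_exp_lt hx0).2 hx
  set H := Real.log x ^ γ * L (Real.log x) with hH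
  have hH0 : 0 < H := mul_pos (Real.rpow_pos_of_pos (by linarith) γ) (hL.pos _ hlog.le)
  have hreg : regTail r γ L x = x ^ (-r) * H := by rw [regTail, hH]; ring
  have hexp : ∀ y z : ℝ, 0 < y → 0 < z →
      Real.exp (δ * (Real.log y - Real.log z)) = y ^ δ * z ^ (-δ) := by
    intro y z hy hz
    rw [Real.rpow_def_of_pos hy, Real.rpow_def_of_pos hz, ← Real.exp_add]
    congr 1
    ring
  have h₁ : ∀ k t, 0 < t → t ≤ x →
      tailFun P (ξ (k + 1)) t ≤ ENNReal.ofReal (K * x ^ δ * H * t ^ (-(r + δ))) := by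
    intro k t ht htx
    rcases lt_or_ge (Real.exp 1) t with hte | hte
    · refine (hξ (k + 1) (by omega) t hte).trans (ENNReal.ofReal_le_ofReal ?_)
      have hlogt : 1 < Real.log t := (Real.lt_log_iff_exp_lt ht).2 hte
      have h3 := hD (Real.log x) (Real.log t) hlog.le hlogt.le
      rw [abs_sub_comm, abs_of_nonneg (sub_nonneg.2 (Real.log_le_log ht htx)), hexp x t hx0 ht,
        ← hH] at h3
      have e : t ^ (-(r + δ)) = t ^ (-r) * t ^ (-δ) := by
        rw [← Real.rpow_add ht]
        congr 1
        ring
      have hDK : D ≤ K := by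
        rw [hK]
        have : 0 ≤ Real.exp 1 ^ (r + δ) * (D / L 1) := by positivity
        linarith
      calc regTail r γ L t = t ^ (-r) * (Real.log t ^ γ * L (Real.log t)) := by
            rw [regTail]; ring
        _ ≤ t ^ (-r) * (D * H * (x ^ δ * t ^ (-δ))) := by gcongr
        _ ≤ t ^ (-r) * (K * H * (x ^ δ * t ^ (-δ))) := by gcongr
        _ = _ := by rw [e]; ring
    · refine prob_le_one.trans ?_
      rw [← ENNReal.ofReal_one]
      refine ENNReal.ofReal_le_ofReal ?_
      have h3 := hD (Real.log x) 1 hlog.le le_rfl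
      rw [abs_sub_comm, abs_of_nonneg (by linarith), Real.one_rpow, one_mul, ← hH] at h3
      have h4 : Real.exp (δ * (Real.log x - 1)) ≤ x ^ δ := by
        rw [Real.rpow_def_of_pos hx0]
        refine Real.exp_le_exp.2 ?_
        nlinarith
      have h5 : 1 ≤ D / L 1 * (x ^ δ * H) := by
        rw [div_mul_eq_mul_div, one_le_div hL1]
        calc L 1 ≤ _ := h3
          _ ≤ D * H * x ^ δ := by gcongr
          _ = _ := by ring
      have h6 : 1 ≤ Real.exp 1 ^ (r + δ) * t ^ (-(r + δ)) := by
        rw [Real.rpow_neg ht.le, ← div_eq_mul_inv, one_le_div (by positivity)]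
        gcongr
      have h7 : 0 ≤ D * (x ^ δ * H * t ^ (-(r + δ))) := by positivity
      calc (1 : ℝ) ≤ (Real.exp 1 ^ (r + δ) * t ^ (-(r + δ))) * (D / L 1 * (x ^ δ * H)) :=
            one_le_mul_of_one_le_of_one_le h6 h5
        _ ≤ (Real.exp 1 ^ (r + δ) * t ^ (-(r + δ))) * (D / L 1 * (x ^ δ * H)) +
            D * (x ^ δ * H * t ^ (-(r + δ))) := le_add_of_nonneg_right h7
        _ = _ := by rw [hK]; ring
  have h₂ : ∀ k t, x ≤ t →
      tailFun P (ξ (k + 1)) t ≤ ENNReal.ofReal (D * x ^ (-δ) * H * t ^ (-(r - δ))) := by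
    intro k t hxt
    have hte : Real.exp 1 < t := hx.trans_le hxt
    have ht : 0 < t := hx0.trans_le hxt
    refine (hξ (k + 1) (by omega) t hte).trans (ENNReal.ofReal_le_ofReal ?_)
    have hlogt : 1 < Real.log t := (Real.lt_log_iff_exp_lt ht).2 hte
    have h3 := hD (Real.log x) (Real.log t) hlog.le hlogt.le
    rw [abs_of_nonneg (sub_nonneg.2 (Real.log_le_log hx0 hxt)), hexp t x ht hx0, ← hH] at h3
    have e : t ^ (-(r - δ)) = t ^ (-r) * t ^ δ := by
      rw [← Real.rpow_add ht]
      congr 1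
      ring
    calc regTail r γ L t = t ^ (-r) * (Real.log t ^ γ * L (Real.log t)) := by
          rw [regTail]; ring
      _ ≤ t ^ (-r) * (D * H * (t ^ δ * x ^ (-δ))) := by gcongr
      _ = _ := by rw [e]; ring
  have hU := h.uniformTail_le_of_tailFun_le (a := r + δ) (b := r - δ) (q := q) (by linarith)
    (by linarith) (by linarith) (by positivity) (by positivity) hx0 h₁ h₂
  refine hU.trans (le_of_eq ?_)
  -- The Potter errors `(x/t)^δ` and `(t/x)^δ` equal 1 at `t = x`, so the exact order of the tail is
  -- recovered.
  have e1 : x ^ δ * x ^ (-(r + δ)) = x ^ (-r) := by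
    rw [← Real.rpow_add hx0]
    congr 1
    ring
  have e2 : x ^ (-δ) * x ^ (-(r - δ)) = x ^ (-r) := by
    rw [← Real.rpow_add hx0]
    congr 1
    ring
  have e3 : K * x ^ δ * H * x ^ (-(r + δ)) = K * (x ^ (-r) * H) := by rw [← e1]; ring
  have e4 : D * x ^ (-δ) * H * x ^ (-(r - δ)) = D * (x ^ (-r) * H) := by rw [← e2]; ring
  rw [hreg, e3, e4]
  congr 1
  ring

theorem normedSum_one {Ω : Type*} (ξ : ℕ → Ω → ℝ) : normedSum ξ 1 = ξ 1 := by
  ext ω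
  simp [normedSum]

theorem theorem5p2 (r : ℝ) (hr : 2 < r) :
    -- a general weight: the constant depends on `r`, `ν` and a bound `K` for the norms
    (∀ ν : ℝ → ℝ≥0∞, IsMomentWeight r ν → ∀ K : ℝ≥0, ∃ C : ℝ, 0 < C ∧
      ∀ (Ω : Type u) (mΩ : MeasurableSpace Ω) (P : Measure Ω) (_ : IsProbabilityMeasure P)
        (ℱ : Filtration ℕ mΩ) (ξ : ℕ → Ω → ℝ), IsMartingaleDifferenceSeq P ℱ ξ →
        (⨆ i : ℕ, ⨆ _ : 1 ≤ i, momentNorm P r ν (ξ i)) ≤ K →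
        ∀ x : ℝ, 0 < x → uniformTail P ξ x ≤ ENNReal.ofReal C * tailTransform r ν x) ∧
    -- the natural weight: the constant depends on `r` and on the law of the sequence
    (∀ law : Measure (ℕ → ℝ), ∃ C : ℝ, 0 < C ∧
      ∀ (Ω : Type u) (mΩ : MeasurableSpace Ω) (P : Measure Ω) (_ : IsProbabilityMeasure P)
        (ℱ : Filtration ℕ mΩ) (ξ : ℕ → Ω → ℝ), IsMartingaleDifferenceSeq P ℱ ξ →
        P.map (fun ω k => ξ (k + 1) ω) = law →
        (∀ p ∈ Ico 1 r, naturalFun P ξ p < ∞) →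
        ∀ x : ℝ, 0 < x →
          uniformTail P ξ x ≤ ENNReal.ofReal C * tailTransform r (naturalFun P ξ) x) ∧
    -- regularly varying tails: the constant depends on `r`, `γ` and `L`
    (∀ (γ : ℝ) (L : ℝ → ℝ), IsSlowlyVarying L → ∃ C : ℝ, 0 < C ∧
      ∀ (Ω : Type u) (mΩ : MeasurableSpace Ω) (P : Measure Ω) (_ : IsProbabilityMeasure P)
        (ℱ : Filtration ℕ mΩ) (ξ : ℕ → Ω → ℝ), IsMartingaleDifferenceSeq P ℱ ξ →
        ((∀ i : ℕ, 1 ≤ i → ∀ x : ℝ, Real.exp 1 < x →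
            tailFun P (ξ i) x ≤ ENNReal.ofReal (regTail r γ L x)) →
          ∀ x : ℝ, Real.exp 1 < x →
            uniformTail P ξ x ≤ ENNReal.ofReal (C * regTail r (γ + 1) L x)) ∧
        ((∀ i : ℕ, 1 ≤ i → ∀ x : ℝ, Real.exp 1 < x →
            tailFun P (ξ i) x = ENNReal.ofReal (regTail r γ L x)) →
          ∀ x : ℝ, Real.exp 1 < x →
            ENNReal.ofReal (regTail r γ L x) ≤ uniformTail P ξ x)) := by

  refine ⟨fun ν hν K => exists_uniformTail_le_of_momentWeight hr hν K,
    exists_uniformTail_le_of_naturalFun hr, fun γ L hL => ?_⟩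
  obtain ⟨C, hC, hU⟩ := exists_uniformTail_le_regTail.{u} hr γ hL
  refine ⟨C, hC, fun Ω mΩ P hP ℱ ξ h => ⟨fun hξ x hx => ?_, fun hξ x hx => ?_⟩⟩
  · refine (hU Ω mΩ P hP ℱ ξ h hξ x hx).trans (ENNReal.ofReal_le_ofReal ?_)
    exact mul_le_mul_of_nonneg_left (regTail_le_regTail_add_one hL hx) hC.le
  -- The lower bound is the term `n = 1` of the supremum.
  · rw [← hξ 1 le_rfl x hx, ← normedSum_one ξ]
    exact le_uniformTail P ξ le_rfl x
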